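/- **Theorem 5.4 (Degenerate Kirchhoff equations in finite dimension).** Let $H$ be a separable real Hilbert space with norm $|\cdot|$, let $B$ be a linear operator on $H$ that is bounded, symmetric and coercive (there is $m>0$ with $\langle Bx,x\rangle\ge m|x|^2$ for all $x\in H$), and let $B^{1/2}$ be its positive square root. Let $\alpha>0$ be real, and consider $$u''(t)+u'(t)+|B^{1/2}u(t)|^{2\alpha}\,Bu(t)=0,\qquad t\ge 0. \tag{K}$$ A solution means a function $u\in C^2([0,+\infty),H)$ satisfying (K) for every $t\ge0$. Then the following hold. 1. *(Global existence and uniqueness)* For every $(u_0,u_1)\in H\times H$ there is a unique solution of (K) with $u(0)=u_0$ and $u'(0)=u_1$. 2. *(Classification of decay rates)* For every solution $u$ of (K) that is not identically zero, exactly one of the following holds: - $u$ is slow: there are $T_0\ge0$ and $C_1,C_2>0$ such that $|u(t)|\ge C_1(1+t)^{-1/(2\alpha)}$ for all $t\ge T_0$ and $|u(t)|\le C_2(1+t)^{-1/(2\alpha)}$ for all $t\ge0$; - $u$ is fast: there is $v_0\in H$, $v_0\ne0$, such that $$\lim_{t\to+\infty}\left(|u'(t)+v_0e^{-t}|+|u(t)-v_0e^{-t}|\right)e^{\gamma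 t}=0\qquad\text{for every real }\gamma<1+2\alpha. \tag{F}$$ 3. *(Existence of slow solutions)* If $H\ne\{0\}$, there is a nonempty open set $\mathcal S\subseteq H\times H$ such that every solution $u$ of (K) with $(u(0),u'(0))\in\mathcal S$ is slow with $T_0=0$. 4. *(Existence of fast solutions)* There is $\varepsilon>0$ such that for every $v_0\in H$ with $0<|v_0|<\varepsilon$ there is at least one solution of (K) satisfying (F). -/

import Mathlib

open Set Filter Topology
open scoped InnerProductSpace

namespace Kirchhoff

/-- A symmetric operator whose quadratic form is bounded by `r` has norm at most `r`. -/
theorem norm_le_of_quadratic_form {H : Type*} [NormedAddCommGroup H] [InnerProductSpace ℝ H]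
    [CompleteSpace H] (C : H →L[ℝ] H) (hC : C.IsSymmetric) {r : ℝ} (hr : 0 ≤ r)
    (h : ∀ x, |⟪C x, x⟫_ℝ| ≤ r * ‖x‖ ^ 2) : ‖C‖ ≤ r := by
  rw [ContinuousLinearMap.norm_eq_iSup_rayleighQuotient C hC]
  refine ciSup_le fun x => ?_
  have h1 := h x
  simp only [ContinuousLinearMap.rayleighQuotient, ContinuousLinearMap.reApplyInnerSelf_apply,
    RCLike.re_to_real, abs_div, abs_pow, abs_norm]
  exact div_le_of_le_mul₀ (by positivity) hr h1

/-- A bounded, symmetric and coercive operator has exactly one positive square root. -/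
theorem existsUnique_sqrt {H : Type*} [NormedAddCommGroup H] [InnerProductSpace ℝ H]
    [CompleteSpace H] (B : H →L[ℝ] H) (hB : B.IsSymmetric)
    (hc : ∃ m : ℝ, 0 < m ∧ ∀ x, m * ‖x‖ ^ 2 ≤ ⟪B x, x⟫_ℝ) :
    ∃! S : H →L[ℝ] H, S.IsPositive ∧ S * S = B := by
  obtain ⟨m, hm, hmB⟩ := hc
  obtain ⟨M, hM0, hMB, hmM⟩ : ∃ M : ℝ, 0 < M ∧ ‖B‖ ≤ M ∧ m ≤ M :=
    ⟨max ‖B‖ m, lt_max_of_lt_right hm, le_max_left _ _, le_max_right _ _⟩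
  set C : H →L[ℝ] H := 1 - M⁻¹ • B with hCdef
  set r : ℝ := 1 - m / M with hrdef
  have hmM1 : m / M ≤ 1 := (div_le_one hM0).2 hmM
  have hmM0 : 0 < m / M := by positivity
  have hr0 : 0 ≤ r := by rw [hrdef]; linarith
  have hr1 : r < 1 := by rw [hrdef]; linarith
  have hBsa : IsSelfAdjoint B := B.isSelfAdjoint_iff_isSymmetric.2 hB
  have hCsa : IsSelfAdjoint C :=
    (IsSelfAdjoint.one _).sub (IsSelfAdjoint.smul (IsSelfAdjoint.all _) hBsa)
  have hCn : ‖C‖ ≤ r := by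
    refine norm_le_of_quadratic_form C (C.isSelfAdjoint_iff_isSymmetric.1 hCsa) hr0 fun x => ?_
    have e : ⟪C x, x⟫_ℝ = ‖x‖ ^ 2 - M⁻¹ * ⟪B x, x⟫_ℝ := by
      simp [hCdef, inner_sub_left, inner_smul_left]
    have h1 : M⁻¹ * (m * ‖x‖ ^ 2) ≤ M⁻¹ * ⟪B x, x⟫_ℝ :=
      mul_le_mul_of_nonneg_left (hmB x) (by positivity)
    have h2 : M⁻¹ * ⟪B x, x⟫_ℝ ≤ ‖x‖ ^ 2 := by
      have : ⟪B x, x⟫_ℝ ≤ M * ‖x‖ ^ 2 := by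
        calc ⟪B x, x⟫_ℝ ≤ ‖B x‖ * ‖x‖ := real_inner_le_norm _ _
          _ ≤ (‖B‖ * ‖x‖) * ‖x‖ := by gcongr; exact B.le_opNorm x
          _ ≤ (M * ‖x‖) * ‖x‖ := by gcongr
          _ = M * ‖x‖ ^ 2 := by ring
      calc M⁻¹ * ⟪B x, x⟫_ℝ ≤ M⁻¹ * (M * ‖x‖ ^ 2) := by gcongr
        _ = ‖x‖ ^ 2 := by field_simp
    rw [e, abs_of_nonneg (by linarith), hrdef]
    have : M⁻¹ * (m * ‖x‖ ^ 2) = m / M * ‖x‖ ^ 2 := by field_simp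
    nlinarith
  -- the square root is `√M (1 - Y)`, where `Y` is the fixed point of `Y ↦ (C + Y²) / 2`
  let K : Set (H →L[ℝ] H) :=
    {Y | ‖Y‖ ≤ r ∧ IsSelfAdjoint Y ∧ ∀ T : H →L[ℝ] H, T * C = C * T → T * Y = Y * T}
  have hKc : IsClosed K := by
    have : K = {Y | ‖Y‖ ≤ r} ∩ ({Y | star Y = Y} ∩
        ⋂ T : H →L[ℝ] H, ⋂ _ : T * C = C * T, {Y | T * Y = Y * T}) := by
      ext Y; simp [K, IsSelfAdjoint]
    rw [this]
    refine (isClosed_le continuous_norm continuous_const).inter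
      ((isClosed_eq continuous_star continuous_id).inter ?_)
    exact isClosed_iInter fun T => isClosed_iInter fun _ =>
      isClosed_eq (continuous_const.mul continuous_id) (continuous_id.mul continuous_const)
  let Φ : (H →L[ℝ] H) → (H →L[ℝ] H) := fun Y => (2⁻¹ : ℝ) • (C + Y * Y)
  have hmaps : MapsTo Φ K K := by
    rintro Y ⟨hY1, hY2, hY3⟩
    refine ⟨?_, ?_, ?_⟩
    · have h1 : ‖Y * Y‖ ≤ r * r := (norm_mul_le Y Y).trans (by gcongr)
      have h2 : ‖C + Y * Y‖ ≤ r + r * r := (norm_add_le _ _).trans (add_le_add hCn h1)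
      simp only [Φ, norm_smul, norm_inv, Real.norm_ofNat]
      nlinarith
    · refine IsSelfAdjoint.smul (IsSelfAdjoint.all _) (hCsa.add ?_)
      rw [IsSelfAdjoint, star_mul, hY2.star_eq]
    · intro T hT
      have h1 := hY3 T hT
      simp only [Φ, mul_smul_comm, smul_mul_assoc, mul_add, add_mul, hT]
      rw [← mul_assoc, h1, mul_assoc, h1, mul_assoc]
  have hlip : ContractingWith ⟨r, hr0⟩ (hmaps.restrict Φ K K) := by
    refine ⟨by exact_mod_cast hr1, LipschitzWith.of_dist_le_mul ?_⟩
    rintro ⟨X, hX1, -, -⟩ ⟨Y, hY1, -, -⟩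
    simp only [Subtype.dist_eq, MapsTo.val_restrict_apply, dist_eq_norm]
    have e : Φ X - Φ Y = (2⁻¹ : ℝ) • (X * (X - Y) + (X - Y) * Y) := by
      simp only [Φ, ← smul_sub]
      congr 1
      noncomm_ring
    have h1 : ‖X * (X - Y)‖ ≤ r * ‖X - Y‖ := (norm_mul_le _ _).trans (by gcongr)
    have h2 : ‖(X - Y) * Y‖ ≤ ‖X - Y‖ * r := (norm_mul_le _ _).trans (by gcongr)
    have h3 := norm_add_le (X * (X - Y)) ((X - Y) * Y)
    rw [e, norm_smul, norm_inv, Real.norm_ofNat]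
    change _ ≤ r * ‖X - Y‖
    linarith
  have h0K : (0 : H →L[ℝ] H) ∈ K := ⟨by simpa using hr0, IsSelfAdjoint.zero _, by simp⟩
  obtain ⟨Y, ⟨hY1, hY2, hY3⟩, hfix, -⟩ :=
    ContractingWith.exists_fixedPoint' hKc.isComplete hmaps hlip h0K (edist_ne_top _ _)
  have hfix' : (2⁻¹ : ℝ) • (C + Y * Y) = Y := hfix
  have hYY : C + Y * Y = (2 : ℝ) • Y := by
    nth_rewrite 3 [← hfix']
    rw [smul_smul]; norm_num
  have hsq : (1 - Y) * (1 - Y) = M⁻¹ • B := by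
    have : (1 - Y) * (1 - Y) = 1 - (2 : ℝ) • Y + Y * Y := by
      rw [two_smul]; noncomm_ring
    rw [this, ← hYY, hCdef]; abel
  set S : H →L[ℝ] H := √M • (1 - Y) with hSdef
  have hSS : S * S = B := by
    rw [hSdef, smul_mul_smul_comm, hsq, Real.mul_self_sqrt hM0.le, smul_smul,
      mul_inv_cancel₀ hM0.ne', one_smul]
  have hScoer : ∀ x, √M * ((1 - r) * ‖x‖ ^ 2) ≤ ⟪S x, x⟫_ℝ := by
    intro x
    have e : ⟪S x, x⟫_ℝ = √M * (‖x‖ ^ 2 - ⟪Y x, x⟫_ℝ) := by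
      simp [hSdef, inner_sub_left, inner_smul_left]
    have h1 : ⟪Y x, x⟫_ℝ ≤ r * ‖x‖ ^ 2 := by
      calc ⟪Y x, x⟫_ℝ ≤ ‖Y x‖ * ‖x‖ := real_inner_le_norm _ _
        _ ≤ (‖Y‖ * ‖x‖) * ‖x‖ := by gcongr; exact Y.le_opNorm x
        _ ≤ (r * ‖x‖) * ‖x‖ := by gcongr
        _ = r * ‖x‖ ^ 2 := by ring
    rw [e]
    exact mul_le_mul_of_nonneg_left (by linarith) (Real.sqrt_nonneg _)
  have hSpos : S.IsPositive := by
    rw [ContinuousLinearMap.isPositive_def']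
    refine ⟨IsSelfAdjoint.smul (IsSelfAdjoint.all _) ((IsSelfAdjoint.one _).sub hY2), fun x => ?_⟩
    have h1 : 0 ≤ √M * ((1 - r) * ‖x‖ ^ 2) :=
      mul_nonneg (Real.sqrt_nonneg _) (mul_nonneg (by linarith) (by positivity))
    exact h1.trans (hScoer x)
  refine ⟨S, ⟨hSpos, hSS⟩, ?_⟩
  rintro T ⟨hTpos, hTT⟩
  have hTC : T * C = C * T := by
    simp only [hCdef, ← hTT]
    simp [mul_sub, sub_mul, mul_assoc]
  have hTS : T * S = S * T := by
    simp [hSdef, mul_sub, sub_mul, hY3 T hTC]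
  ext x
  set z : H := T x - S x with hz
  have hz0 : S z + T z = 0 := by
    have : (S + T) * (T - S) = 0 := by
      have : (S + T) * (T - S) = S * T - S * S + T * T - T * S := by noncomm_ring
      rw [this, hTS, hTT, hSS]; abel
    simpa [hz] using! congrArg (fun A : H →L[ℝ] H => A x) this
  have hi : ⟪S z, z⟫_ℝ + ⟪T z, z⟫_ℝ = 0 := by rw [← inner_add_left, hz0, inner_zero_left]
  have hSz : 0 ≤ ⟪S z, z⟫_ℝ := hSpos.inner_nonneg_left z
  have hTz : 0 ≤ ⟪T z, z⟫_ℝ := hTpos.inner_nonneg_left z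
  have hzz : √M * ((1 - r) * ‖z‖ ^ 2) ≤ 0 := (hScoer z).trans (by linarith)
  have hzn : ‖z‖ ^ 2 = 0 := by
    have h1 : 0 < √M * (1 - r) := mul_pos (Real.sqrt_pos.2 hM0) (by linarith)
    have h2 : 0 ≤ ‖z‖ ^ 2 := by positivity
    nlinarith
  exact sub_eq_zero.1 (norm_eq_zero.1 (pow_eq_zero_iff two_ne_zero |>.1 hzn))

/-- The square root `B^{1/2}`: the positive operator whose square is `B`
(an arbitrary operator if there is none). -/
noncomputable def sqrtOp {H : Type*} [NormedAddCommGroup H] [InnerProductSpace ℝ H]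
    (B : H →L[ℝ] H) : H →L[ℝ] H :=
  Classical.epsilon fun S : H →L[ℝ] H => S.IsPositive ∧ S * S = B

/-- For bounded, symmetric and coercive `B`, `sqrtOp B` is the positive square root of `B`. -/
theorem sqrtOp_spec {H : Type*} [NormedAddCommGroup H] [InnerProductSpace ℝ H]
    [CompleteSpace H] (B : H →L[ℝ] H) (hB : B.IsSymmetric)
    (hc : ∃ m : ℝ, 0 < m ∧ ∀ x, m * ‖x‖ ^ 2 ≤ ⟪B x, x⟫_ℝ) :
    (sqrtOp B).IsPositive ∧ sqrtOp B * sqrtOp B = B :=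
  Classical.epsilon_spec (existsUnique_sqrt B hB hc).exists

/-- The time derivative on `[0, ∞)`, one-sided at `0`. -/
noncomputable def timeDeriv {H : Type*} [NormedAddCommGroup H] [InnerProductSpace ℝ H]
    (u : ℝ → H) : ℝ → H :=
  derivWithin u (Ici 0)

/-- `u` is a global solution, of class `C²` on `[0, ∞)`, of
`u'' + u' + |B^{1/2} u|^{2α} B u = 0`. The values of `u` at negative times are irrelevant. -/
structure IsGlobalSolution {H : Type*} [NormedAddCommGroup H] [InnerProductSpace ℝ H]
    (B : H →L[ℝ] H) (α : ℝ) (u : ℝ → H) : Prop where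
  contDiffOn : ContDiffOn ℝ 2 u (Ici 0)
  equation : ∀ t, 0 ≤ t → timeDeriv (timeDeriv u) t + timeDeriv u t
    + ‖sqrtOp B (u t)‖ ^ (2 * α) • B (u t) = 0

/-- `u` has initial data `u(0) = u₀`, `u'(0) = u₁`. -/
def HasInitialData {H : Type*} [NormedAddCommGroup H] [InnerProductSpace ℝ H]
    (u : ℝ → H) (u₀ u₁ : H) : Prop :=
  u 0 = u₀ ∧ timeDeriv u 0 = u₁

/-- The two-sided bound `C₁ (1+t)^{-1/(2α)} ≤ |u(t)| ≤ C₂ (1+t)^{-1/(2α)}`, the lower one for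
`t ≥ T₀` (as `u` may vanish at earlier times), the upper one for all `t ≥ 0`. -/
def IsSlowFrom {H : Type*} [NormedAddCommGroup H] [InnerProductSpace ℝ H]
    (α : ℝ) (T₀ : ℝ) (u : ℝ → H) : Prop :=
  ∃ C₁ C₂ : ℝ, 0 < C₁ ∧ 0 < C₂ ∧
    (∀ t, T₀ ≤ t → C₁ / (1 + t) ^ (1 / (2 * α)) ≤ ‖u t‖) ∧
    (∀ t, 0 ≤ t → ‖u t‖ ≤ C₂ / (1 + t) ^ (1 / (2 * α)))

/-- `u` has the fast profile `v₀ e^{-t}`: both `u - v₀ e^{-t}` and `u' + v₀ e^{-t}` are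
`o(e^{-γ t})` for every `γ < 1 + 2α`. -/
def HasFastProfile {H : Type*} [NormedAddCommGroup H] [InnerProductSpace ℝ H]
    (α : ℝ) (v₀ : H) (u : ℝ → H) : Prop :=
  ∀ γ : ℝ, γ < 1 + 2 * α →
    Tendsto (fun t : ℝ => (‖timeDeriv u t + Real.exp (-t) • v₀‖
      + ‖u t - Real.exp (-t) • v₀‖) * Real.exp (γ * t)) atTop (𝓝 0)

end Kirchhoff

/-!
Set `v = u'` and write the equation as the first-order system `u' = v`, `v' = -v - f(u)` with the
locally Lipschitz force `f(x) = ⟪B x, x⟫ ^ α • B x`, homogeneous of degree `1 + 2α` (`force`).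

*Well-posedness.* Freezing the scalar factor of `f` outside `|B^{1/2} x| ≤ R` gives a globally
Lipschitz field, which has global solutions. The energy `|v|² + |B^{1/2} u|^{2α+2} / (α+1)` does not
increase, so for large `R` the truncation is never active (`exists_isPhaseCurve`). Uniqueness holds
forwards and backwards in time (`IsPhaseCurve.eq_of_eq_at`), so a solution that is not identically
zero never meets the rest state. The energy tends to `0` (`IsPhaseCurve.tendsto_energy`); hence
eventually `|f(u)| ≤ η |u|` with `η` as small as desired.

*The alternative.* The linear part has the central direction `w = u + v`, with `w' = -f(u)`, and the
stable direction `v`. For small `κ` the cone `|v| ≤ κ |w|` is forward invariant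
(`IsPhaseCurve.cone_invariant`).
If the solution enters it, then `u` is comparable to `w`, and coercivity of `B` gives
`(|w|²)' ≈ -|w|^{2α+2}`, so that `|w|^{-2α}` grows linearly: the solution is slow
(`IsPhaseCurve.exists_bounds_of_cone`).
If it never does, then `v` controls everything, `v' = -v + o(v)`, and a bootstrap on the decay rate
of `v` shows that `e^t v` has a nonzero limit with error `O(e^{-2αt})`: the solution is fast
(`IsPhaseCurve.exists_fastProfile`). No solution is both, since `e^{-t/2}` beats every power of `t`.

*Existence.* Data of small energy in the interior of the cone form a nonempty open set and give slow
solutions from time `0` on (`exists_open_slow`). A solution with fast profile `v₀ e^{-t}` corresponds,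
through `z = e^t u` and homogeneity of `f`, to a fixed point
`z(t) = v₀ - ∫_t^∞ (1 - e^{t-s}) e^{-2αs} f(z(s)) ds`, found by contraction for small `v₀`
(`exists_fast_solution`).
-/

namespace Kirchhoff

/-! ### Calculus on half-lines -/

theorem le_of_hasDerivWithinAt_nonpos {T : ℝ} {y y' : ℝ → ℝ}
    (hy : ∀ t, T ≤ t → HasDerivWithinAt y (y' t) (Ici T) t) (hy' : ∀ t, T ≤ t → y' t ≤ 0)
    {t : ℝ} (ht : T ≤ t) : y t ≤ y T := by
  have h : AntitoneOn y (Ici T) := by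
    refine antitoneOn_of_hasDerivWithinAt_nonpos (f' := y') (convex_Ici T)
      (fun s hs => (hy s hs).continuousWithinAt) (fun s hs => ?_) (fun s hs => ?_)
    · exact (hy s (interior_subset hs)).mono interior_subset
    · exact hy' s (interior_subset hs)
  exact h self_mem_Ici ht ht

/-- A curve whose velocity decays exponentially converges, at the same exponential rate. -/
theorem exists_limit_of_norm_deriv_le_exp {E : Type*} [NormedAddCommGroup E] [NormedSpace ℝ E]
    [CompleteSpace E] {T c C : ℝ} (hc : 0 < c) {y y' : ℝ → E}
    (hy : ∀ t, T ≤ t → HasDerivWithinAt y (y' t) (Ici T) t)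
    (hy' : ∀ t, T ≤ t → ‖y' t‖ ≤ C * Real.exp (-(c * t))) :
    ∃ L : E, Tendsto y atTop (𝓝 L) ∧
      ∀ t, T ≤ t → ‖y t - L‖ ≤ C / c * Real.exp (-(c * t)) := by
  have hC : 0 ≤ C := by
    have := (norm_nonneg _).trans (hy' T le_rfl)
    exact nonneg_of_mul_nonneg_left this (Real.exp_pos _)
  have key : ∀ s t, T ≤ s → s ≤ t → ‖y t - y s‖ ≤ C / c * Real.exp (-(c * s)) := by
    intro s t hs hst
    have h := image_norm_le_of_norm_deriv_right_le_deriv_boundary (a := s) (b := t)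
      (f := fun r => y r - y s) (f' := y')
      (B := fun r => C / c * Real.exp (-(c * s)) - C / c * Real.exp (-(c * r)))
      (B' := fun r => C * Real.exp (-(c * r)))
      (fun r hr => (((hy r (hs.trans hr.1)).continuousWithinAt.mono
        fun q hq => hs.trans hq.1).sub continuousWithinAt_const))
      (fun r hr => ((hy r (hs.trans hr.1)).mono
        (Ici_subset_Ici.2 (hs.trans hr.1))).sub_const _)
      (by simp)
      (fun r => by
        have h1 : HasDerivAt (fun r : ℝ => -(c * r)) (-(c * 1)) r :=
          ((hasDerivAt_id r).const_mul c).neg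
        have h2 := (h1.exp.const_mul (C / c)).const_sub (C / c * Real.exp (-(c * s)))
        refine h2.congr_deriv ?_
        field_simp)
      (fun r hr => hy' r (hs.trans hr.1)) (right_mem_Icc.2 hst)
    refine h.trans ?_
    have : 0 ≤ C / c * Real.exp (-(c * t)) := by positivity
    linarith
  have hlim : Tendsto (fun s : ℝ => C / c * Real.exp (-(c * s))) atTop (𝓝 0) := by
    have h1 : Tendsto (fun s : ℝ => -(c * s)) atTop atBot :=
      tendsto_neg_atTop_atBot.comp (tendsto_id.const_mul_atTop hc)
    simpa using (Real.tendsto_exp_atBot.comp h1).const_mul (C / c)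
  have hcau : CauchySeq y := by
    rw [Metric.cauchySeq_iff']
    intro ε hε
    obtain ⟨N, hN⟩ := ((hlim.eventually (gt_mem_nhds hε)).and (eventually_ge_atTop T)).exists
    exact ⟨N, fun n hn => by rw [dist_eq_norm]; exact (key N n hN.2 hn).trans_lt hN.1⟩
  obtain ⟨L, hL⟩ := cauchySeq_tendsto_of_complete hcau
  refine ⟨L, hL, fun t ht => ?_⟩
  rw [norm_sub_rev]
  refine le_of_tendsto ((hL.sub_const (y t)).norm) ?_
  filter_upwards [eventually_ge_atTop t] with r hr using key t r ht hr

/-- The Picard iteration for a globally Lipschitz field `G` with `G 0 = 0`, run in the Banach space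
of bounded continuous functions with the weight `e^{-(2K+1)t}`, gives a solution on all of
`[0, ∞)` at once. -/
theorem exists_solution_of_lipschitz {E : Type*} [NormedAddCommGroup E] [NormedSpace ℝ E]
    [CompleteSpace E] {G : E → E} {K : ℝ} (hK : 0 ≤ K)
    (hG : ∀ x y, ‖G x - G y‖ ≤ K * ‖x - y‖) (hG0 : G 0 = 0) (x₀ : E) :
    ∃ x : ℝ → E, x 0 = x₀ ∧ ∀ t, 0 ≤ t → HasDerivWithinAt x (G (x t)) (Ici 0) t := by
  have hGc : Continuous G :=
    (LipschitzWith.of_dist_le_mul (K := ⟨K, hK⟩) (f := G)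
      (fun x y => by rw [dist_eq_norm, dist_eq_norm]; exact hG x y)).continuous
  set l : ℝ := 2 * K + 1 with hl
  have hl0 : 0 < l := by positivity
  let X := BoundedContinuousFunction ℝ E
  let g : X → ℝ → E := fun y s => G (Real.exp (l * s) • y s)
  have hgc : ∀ y : X, Continuous (g y) := fun y =>
    hGc.comp ((Real.continuous_exp.comp (continuous_const.mul continuous_id)).smul y.continuous)
  -- `P y t` is the value at `t` of the next Picard iterate, constant for negative times
  let P : X → ℝ → E := fun y t => x₀ + ∫ s in (0 : ℝ)..(max t 0), g y s
  have hPc : ∀ y : X, Continuous (P y) := fun y => by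
    refine continuous_const.add ?_
    exact (intervalIntegral.continuous_primitive
      (fun a b => (hgc y).intervalIntegrable a b) 0).comp (continuous_id.max continuous_const)
  have hint : ∀ t, 0 ≤ t → ∀ (h : ℝ → E) (D : ℝ), 0 ≤ D →
      (∀ s, ‖h s‖ ≤ D * Real.exp (l * s)) →
      ‖∫ s in (0 : ℝ)..t, h s‖ ≤ D / l * Real.exp (l * t) := by
    intro t ht h D hD hh
    have h1 : ‖∫ s in (0 : ℝ)..t, h s‖ ≤ ∫ s in (0 : ℝ)..t, D * Real.exp (l * s) :=
      intervalIntegral.norm_integral_le_of_norm_le ht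
        (Filter.Eventually.of_forall fun s _ => hh s)
        (Continuous.intervalIntegrable (by fun_prop) _ _)
    refine h1.trans ?_
    have h2 : ∫ s in (0 : ℝ)..t, D * Real.exp (l * s)
        = D / l * Real.exp (l * t) - D / l * Real.exp (l * 0) := by
      refine intervalIntegral.integral_eq_sub_of_hasDerivAt
        (f := fun s => D / l * Real.exp (l * s)) (fun s _ => ?_)
        (Continuous.intervalIntegrable (by fun_prop) _ _)
      have h3 : HasDerivAt (fun r : ℝ => l * r) (l * 1) s := (hasDerivAt_id s).const_mul l
      refine (h3.exp.const_mul (D / l)).congr_deriv ?_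
      field_simp
    rw [h2]
    have : 0 ≤ D / l * Real.exp (l * 0) := by positivity
    linarith
  have hgl : ∀ (y z : X) s, ‖g y s - g z s‖ ≤ (K * ‖y - z‖) * Real.exp (l * s) := by
    intro y z s
    refine (hG _ _).trans ?_
    rw [← smul_sub, norm_smul, Real.norm_of_nonneg (Real.exp_pos _).le]
    have : ‖y s - z s‖ ≤ ‖y - z‖ := (y - z).norm_coe_le_norm s
    calc K * (Real.exp (l * s) * ‖y s - z s‖) ≤ K * (Real.exp (l * s) * ‖y - z‖) := by gcongr
      _ = _ := by ring
  have hgz : ∀ s, g 0 s = 0 := fun s => by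
    change G (Real.exp (l * s) • (0 : E)) = 0
    rw [smul_zero, hG0]
  have hb : ∀ y : X, ∀ t, ‖Real.exp (-(l * max t 0)) • P y t‖ ≤ ‖x₀‖ + K * ‖y‖ / l := by
    intro y t
    have ht : 0 ≤ max t 0 := le_max_right _ _
    have h1 := hint (max t 0) ht (g y) (K * ‖y‖) (by positivity) (fun s => by
      simpa [hgz] using hgl y 0 s)
    rw [norm_smul, Real.norm_of_nonneg (Real.exp_pos _).le]
    have h2 : Real.exp (-(l * max t 0)) ≤ 1 := Real.exp_le_one_iff.2 (by
      have := mul_nonneg hl0.le ht; linarith)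
    have h3 : Real.exp (-(l * max t 0)) * Real.exp (l * max t 0) = 1 := by
      rw [← Real.exp_add]; simp
    calc Real.exp (-(l * max t 0)) * ‖P y t‖
        ≤ Real.exp (-(l * max t 0)) * (‖x₀‖ + K * ‖y‖ / l * Real.exp (l * max t 0)) := by
          gcongr
          exact (norm_add_le _ _).trans (by gcongr)
      _ = Real.exp (-(l * max t 0)) * ‖x₀‖
          + K * ‖y‖ / l * (Real.exp (-(l * max t 0)) * Real.exp (l * max t 0)) := by ring
      _ ≤ 1 * ‖x₀‖ + K * ‖y‖ / l := by rw [h3, mul_one]; gcongr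
      _ = _ := by ring
  let Φ : X → X := fun y => BoundedContinuousFunction.ofNormedAddCommGroup
    (fun t => Real.exp (-(l * max t 0)) • P y t)
    ((Real.continuous_exp.comp (by fun_prop)).smul (hPc y)) _ (hb y)
  have hlip : ContractingWith ⟨K / l, by positivity⟩ Φ := by
    refine ⟨?_, LipschitzWith.of_dist_le_mul fun y z => ?_⟩
    · change K / l < 1
      rw [div_lt_one hl0]; linarith
    · rw [dist_eq_norm, dist_eq_norm]
      change _ ≤ K / l * ‖y - z‖
      refine (BoundedContinuousFunction.norm_le (by positivity)).2 fun t => ?_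
      have ht : 0 ≤ max t 0 := le_max_right _ _
      have e : (Φ y - Φ z) t = Real.exp (-(l * max t 0)) •
          ∫ s in (0 : ℝ)..(max t 0), (g y s - g z s) := by
        rw [intervalIntegral.integral_sub ((hgc y).intervalIntegrable _ _)
          ((hgc z).intervalIntegrable _ _)]
        change Real.exp (-(l * max t 0)) • P y t - Real.exp (-(l * max t 0)) • P z t = _
        rw [← smul_sub]
        simp [P]
      rw [e, norm_smul, Real.norm_of_nonneg (Real.exp_pos _).le]
      have h1 := hint (max t 0) ht (fun s => g y s - g z s) (K * ‖y - z‖) (by positivity) (hgl y z)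
      have h3 : Real.exp (-(l * max t 0)) * Real.exp (l * max t 0) = 1 := by
        rw [← Real.exp_add]; simp
      calc _ ≤ Real.exp (-(l * max t 0)) * (K * ‖y - z‖ / l * Real.exp (l * max t 0)) := by gcongr
        _ = K / l * ‖y - z‖ * (Real.exp (-(l * max t 0)) * Real.exp (l * max t 0)) := by ring
        _ = _ := by rw [h3, mul_one]
  set y : X := hlip.fixedPoint with hy
  have hfix : Φ y = y := hlip.fixedPoint_isFixedPt
  have hyt : ∀ t, 0 ≤ t → Real.exp (l * t) • y t = x₀ + ∫ s in (0 : ℝ)..t, g y s := by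
    intro t ht
    have h1 : y t = Real.exp (-(l * max t 0)) • P y t := by
      conv_lhs => rw [← hfix]
      rfl
    rw [h1, max_eq_left ht, smul_smul, ← Real.exp_add]
    simp [P, max_eq_left ht]
  refine ⟨fun t => Real.exp (l * t) • y t, by simpa using hyt 0 le_rfl, fun t ht => ?_⟩
  have h1 : HasDerivAt (fun t => x₀ + ∫ s in (0 : ℝ)..t, g y s) (g y t) t :=
    (intervalIntegral.integral_hasDerivAt_right ((hgc y).intervalIntegrable _ _)
      ((hgc y).stronglyMeasurableAtFilter _ _) (hgc y).continuousAt).const_add x₀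
  exact h1.hasDerivWithinAt.congr (fun s hs => hyt s hs) (hyt t ht)

variable {H : Type*} [NormedAddCommGroup H] [InnerProductSpace ℝ H]

/-! ### The restoring force and its truncation -/

/-- The restoring force `|B^{1/2} x|^{2α} B x`, written with `⟪B x, x⟫ = |B^{1/2} x|²`. -/
noncomputable def force (B : H →L[ℝ] H) (α : ℝ) (x : H) : H := ⟪B x, x⟫_ℝ ^ α • B x

/-- The restoring force with the scalar factor frozen outside `|B^{1/2} x| ≤ R`; unlike `force`,
it is globally Lipschitz. -/
noncomputable def truncForce (B : H →L[ℝ] H) (α R : ℝ) (x : H) : H :=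
  min ‖sqrtOp B x‖ R ^ (2 * α) • B x

theorem inner_self_nonneg_of_coercive {B : H →L[ℝ] H} {m : ℝ} (hm : 0 < m)
    (hc : ∀ x, m * ‖x‖ ^ 2 ≤ ⟪B x, x⟫_ℝ) (x : H) : 0 ≤ ⟪B x, x⟫_ℝ :=
  le_trans (by positivity) (hc x)

theorem inner_le_opNorm (B : H →L[ℝ] H) (x : H) : ⟪B x, x⟫_ℝ ≤ ‖B‖ * ‖x‖ ^ 2 := by
  calc ⟪B x, x⟫_ℝ ≤ ‖B x‖ * ‖x‖ := real_inner_le_norm _ _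
    _ ≤ (‖B‖ * ‖x‖) * ‖x‖ := by gcongr; exact B.le_opNorm x
    _ = ‖B‖ * ‖x‖ ^ 2 := by ring

theorem norm_sqrtOp_sq [CompleteSpace H] {B : H →L[ℝ] H} {m : ℝ} (hs : B.IsSymmetric)
    (hm : 0 < m) (hc : ∀ x, m * ‖x‖ ^ 2 ≤ ⟪B x, x⟫_ℝ) (x : H) :
    ‖sqrtOp B x‖ ^ 2 = ⟪B x, x⟫_ℝ := by
  obtain ⟨hp, hS⟩ := sqrtOp_spec B hs ⟨m, hm, hc⟩
  have h : sqrtOp B (sqrtOp B x) = B x := congrArg (fun A : H →L[ℝ] H => A x) hS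
  rw [← real_inner_self_eq_norm_sq, ← h]
  exact (hp.1 (sqrtOp B x) x).symm

theorem norm_sqrtOp_rpow [CompleteSpace H] {B : H →L[ℝ] H} {m : ℝ} (hs : B.IsSymmetric)
    (hm : 0 < m) (hc : ∀ x, m * ‖x‖ ^ 2 ≤ ⟪B x, x⟫_ℝ) (α : ℝ) (x : H) :
    ‖sqrtOp B x‖ ^ (2 * α) = ⟪B x, x⟫_ℝ ^ α := by
  rw [← norm_sqrtOp_sq hs hm hc, Real.rpow_mul (norm_nonneg _), Real.rpow_two]

theorem truncForce_eq_force [CompleteSpace H] {B : H →L[ℝ] H} {m : ℝ} (hs : B.IsSymmetric)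
    (hm : 0 < m) (hc : ∀ x, m * ‖x‖ ^ 2 ≤ ⟪B x, x⟫_ℝ) {α R : ℝ} {x : H}
    (hx : ‖sqrtOp B x‖ ≤ R) : truncForce B α R x = force B α x := by
  rw [truncForce, force, min_eq_left hx, norm_sqrtOp_rpow hs hm hc]

@[simp] theorem force_zero (B : H →L[ℝ] H) (α : ℝ) : force B α 0 = 0 := by simp [force]

@[simp] theorem truncForce_zero (B : H →L[ℝ] H) (α R : ℝ) : truncForce B α R 0 = 0 := by
  simp [truncForce]

theorem rpow_sub_rpow_mul_le {a b p : ℝ} (hb : 0 ≤ b) (hab : b ≤ a) (hp : 0 < p) :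
    (a ^ p - b ^ p) * b ≤ p * a ^ p * (a - b) := by
  rcases hb.eq_or_lt with rfl | hb
  · have : 0 ≤ a ^ p := Real.rpow_nonneg hab _
    simp only [mul_zero, sub_zero]
    positivity
  have ha : 0 < a := hb.trans_le hab
  have h1 : Real.log (a / b) ≤ a / b - 1 := Real.log_le_sub_one_of_pos (by positivity)
  have h2 : b ^ p = a ^ p * Real.exp (-(p * Real.log (a / b))) := by
    rw [Real.rpow_def_of_pos ha, Real.rpow_def_of_pos hb, ← Real.exp_add,
      Real.log_div ha.ne' hb.ne']
    ring_nf
  have h3 := Real.add_one_le_exp (-(p * Real.log (a / b)))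
  have h4 : 0 < a ^ p := Real.rpow_pos_of_pos ha _
  have h5 : 1 - Real.exp (-(p * Real.log (a / b))) ≤ p * (a / b - 1) := by
    have := mul_le_mul_of_nonneg_left h1 hp.le
    linarith
  calc (a ^ p - b ^ p) * b = a ^ p * (1 - Real.exp (-(p * Real.log (a / b)))) * b := by
        rw [h2]; ring
    _ ≤ a ^ p * (p * (a / b - 1)) * b := by gcongr
    _ = p * a ^ p * (a - b) := by field_simp

theorem min_rpow_sub_min_rpow_mul_le {a b p R : ℝ} (hb : 0 ≤ b) (hab : b ≤ a) (hp : 0 < p)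
    (hR : 0 ≤ R) :
    (min a R ^ p - min b R ^ p) * b ≤ p * R ^ p * (a - b) := by
  have hRp : 0 ≤ R ^ p := Real.rpow_nonneg hR _
  have hab' : 0 ≤ a - b := by linarith
  rcases le_total R b with h | h
  · rw [min_eq_right h, min_eq_right (h.trans hab), sub_self, zero_mul]
    positivity
  · rw [min_eq_left h]
    have hbm : b ≤ min a R := le_min hab h
    refine (rpow_sub_rpow_mul_le hb hbm hp).trans ?_
    have h1 : min a R ^ p ≤ R ^ p :=
      Real.rpow_le_rpow (hb.trans hbm) (min_le_right _ _) hp.le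
    have h2 : min a R - b ≤ a - b := by linarith [min_le_left a R]
    have h3 : 0 ≤ min a R - b := by linarith
    gcongr

/-- The Lipschitz constant tends to `0` with `R`: near the origin the force is superlinear. -/
theorem norm_truncForce_sub_le [CompleteSpace H] {B : H →L[ℝ] H} {m : ℝ} (hs : B.IsSymmetric)
    (hm : 0 < m) (hc : ∀ x, m * ‖x‖ ^ 2 ≤ ⟪B x, x⟫_ℝ) {α R : ℝ} (hα : 0 < α) (hR : 0 ≤ R)
    (x y : H) :
    ‖truncForce B α R x - truncForce B α R y‖
      ≤ R ^ (2 * α) * (‖B‖ + 2 * α * ‖sqrtOp B‖ ^ 2) * ‖x - y‖ := by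
  wlog hxy : ‖sqrtOp B y‖ ≤ ‖sqrtOp B x‖ generalizing x y
  · rw [norm_sub_rev, norm_sub_rev x]
    exact this y x (le_of_not_ge hxy)
  obtain ⟨-, hS⟩ := sqrtOp_spec B hs ⟨m, hm, hc⟩
  have hBy : ‖B y‖ ≤ ‖sqrtOp B‖ * ‖sqrtOp B y‖ := by
    have h : sqrtOp B (sqrtOp B y) = B y := congrArg (fun A : H →L[ℝ] H => A y) hS
    rw [← h]
    exact (sqrtOp B).le_opNorm _
  set a := ‖sqrtOp B x‖
  set b := ‖sqrtOp B y‖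
  have hb : 0 ≤ b := norm_nonneg _
  have hp : 0 < 2 * α := by positivity
  have hmono : min b R ^ (2 * α) ≤ min a R ^ (2 * α) :=
    Real.rpow_le_rpow (le_min hb hR) (min_le_min_right _ hxy) hp.le
  have hab : a - b ≤ ‖sqrtOp B‖ * ‖x - y‖ := by
    refine (norm_sub_norm_le _ _).trans ?_
    rw [← map_sub]
    exact (sqrtOp B).le_opNorm _
  have e : truncForce B α R x - truncForce B α R y = min a R ^ (2 * α) • B (x - y)
      + (min a R ^ (2 * α) - min b R ^ (2 * α)) • B y := by
    simp only [truncForce, map_sub, smul_sub, sub_smul, a, b]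
    abel
  have ha0 : 0 ≤ min a R ^ (2 * α) := Real.rpow_nonneg (le_min (norm_nonneg _) hR) _
  have haR : min a R ^ (2 * α) ≤ R ^ (2 * α) :=
    Real.rpow_le_rpow (le_min (norm_nonneg _) hR) (min_le_right _ _) hp.le
  have hR0 : 0 ≤ R ^ (2 * α) := Real.rpow_nonneg hR _
  have h1 : ‖min a R ^ (2 * α) • B (x - y)‖ ≤ R ^ (2 * α) * (‖B‖ * ‖x - y‖) := by
    rw [norm_smul, Real.norm_of_nonneg ha0]
    gcongr
    exact B.le_opNorm _
  have h2 : ‖(min a R ^ (2 * α) - min b R ^ (2 * α)) • B y‖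
      ≤ ‖sqrtOp B‖ * (2 * α * R ^ (2 * α) * (‖sqrtOp B‖ * ‖x - y‖)) := by
    rw [norm_smul, Real.norm_of_nonneg (sub_nonneg.2 hmono)]
    calc _ ≤ (min a R ^ (2 * α) - min b R ^ (2 * α)) * (‖sqrtOp B‖ * b) := by
          gcongr
      _ = ‖sqrtOp B‖ * ((min a R ^ (2 * α) - min b R ^ (2 * α)) * b) := by ring
      _ ≤ ‖sqrtOp B‖ * (2 * α * R ^ (2 * α) * (a - b)) := by
          exact mul_le_mul_of_nonneg_left (min_rpow_sub_min_rpow_mul_le hb hxy hp hR)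
            (norm_nonneg _)
      _ ≤ _ := by gcongr
  rw [e]
  refine (norm_add_le _ _).trans ((add_le_add h1 h2).trans (le_of_eq ?_))
  ring

theorem norm_force_le {B : H →L[ℝ] H} {m : ℝ}
    (hm : 0 < m) (hc : ∀ x, m * ‖x‖ ^ 2 ≤ ⟪B x, x⟫_ℝ) {α : ℝ} (hα : 0 < α) (x : H) :
    ‖force B α x‖ ≤ ‖B‖ ^ α * ‖B‖ * ‖x‖ ^ (2 * α) * ‖x‖ := by
  have h0 := inner_self_nonneg_of_coercive hm hc x
  rw [force, norm_smul, Real.norm_of_nonneg (Real.rpow_nonneg h0 _)]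
  have h1 : ⟪B x, x⟫_ℝ ^ α ≤ ‖B‖ ^ α * ‖x‖ ^ (2 * α) := by
    rw [Real.rpow_mul (norm_nonneg x), Real.rpow_two, ← Real.mul_rpow (by positivity) (by positivity)]
    exact Real.rpow_le_rpow h0 (inner_le_opNorm B x) hα.le
  calc _ ≤ (‖B‖ ^ α * ‖x‖ ^ (2 * α)) * (‖B‖ * ‖x‖) := by
        gcongr
        exact B.le_opNorm x
    _ = _ := by ring

theorem force_smul {B : H →L[ℝ] H} {m : ℝ}
    (hm : 0 < m) (hc : ∀ x, m * ‖x‖ ^ 2 ≤ ⟪B x, x⟫_ℝ) {α c : ℝ} (hcp : 0 ≤ c) (x : H) :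
    force B α (c • x) = (c ^ (2 * α) * c) • force B α x := by
  have h0 := inner_self_nonneg_of_coercive hm hc x
  rw [force, force, map_smul, real_inner_smul_left, real_inner_smul_right, ← mul_assoc,
    Real.mul_rpow (by positivity) h0, Real.rpow_mul hcp, Real.rpow_two, sq, smul_smul, smul_smul]
  congr 1
  ring

/-! ### Phase curves -/

/-- `(u, v)` solves the first-order system `u' = v`, `v' = -v - g(u)` on `[0, ∞)`. -/
structure IsPhaseCurve (g : H → H) (u v : ℝ → H) : Prop where
  deriv_pos : ∀ t, 0 ≤ t → HasDerivWithinAt u (v t) (Ici 0) t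
  deriv_vel : ∀ t, 0 ≤ t → HasDerivWithinAt v (-v t - g (u t)) (Ici 0) t

namespace IsPhaseCurve

variable {g : H → H} {u v : ℝ → H}

theorem continuousOn_pos (h : IsPhaseCurve g u v) : ContinuousOn u (Ici 0) :=
  fun t ht => (h.deriv_pos t ht).continuousWithinAt

theorem continuousOn_vel (h : IsPhaseCurve g u v) : ContinuousOn v (Ici 0) :=
  fun t ht => (h.deriv_vel t ht).continuousWithinAt

theorem timeDeriv_eq (h : IsPhaseCurve g u v) {t : ℝ} (ht : 0 ≤ t) : timeDeriv u t = v t :=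
  (h.deriv_pos t ht).derivWithin (uniqueDiffOn_Ici 0 t ht)

end IsPhaseCurve

theorem continuous_force {B : H →L[ℝ] H} {α : ℝ} (hα : 0 < α) : Continuous (force B α) := by
  refine Continuous.smul (f := fun x => ⟪B x, x⟫_ℝ ^ α) ?_ B.continuous
  exact (B.continuous.inner continuous_id).rpow_const fun _ => Or.inr hα.le

theorem IsGlobalSolution.isPhaseCurve [CompleteSpace H] {B : H →L[ℝ] H} {m : ℝ}
    (hs : B.IsSymmetric) (hm : 0 < m) (hc : ∀ x, m * ‖x‖ ^ 2 ≤ ⟪B x, x⟫_ℝ) {α : ℝ} {u : ℝ → H}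
    (h : IsGlobalSolution B α u) : IsPhaseCurve (force B α) u (timeDeriv u) := by
  have h2 : ContDiffOn ℝ (1 + 1) u (Ici 0) := by
    have := h.contDiffOn
    rwa [← one_add_one_eq_two] at this
  rw [contDiffOn_succ_iff_derivWithin (uniqueDiffOn_Ici 0)] at h2
  refine ⟨fun t ht => (h2.1 t ht).hasDerivWithinAt, fun t ht => ?_⟩
  have h3 := (h2.2.2.differentiableOn (by simp) t ht).hasDerivWithinAt
  refine h3.congr_deriv ?_
  have h4 := h.equation t ht
  rw [norm_sqrtOp_rpow hs hm hc] at h4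
  change timeDeriv (timeDeriv u) t = -timeDeriv u t - force B α (u t)
  rw [add_assoc] at h4
  rw [eq_neg_of_add_eq_zero_left h4, force]
  abel

theorem IsPhaseCurve.isGlobalSolution [CompleteSpace H] {B : H →L[ℝ] H} {m : ℝ}
    (hs : B.IsSymmetric) (hm : 0 < m) (hc : ∀ x, m * ‖x‖ ^ 2 ≤ ⟪B x, x⟫_ℝ) {α : ℝ} (hα : 0 < α)
    {u v : ℝ → H} (h : IsPhaseCurve (force B α) u v) : IsGlobalSolution B α u := by
  have e1 : EqOn (timeDeriv u) v (Ici 0) := fun t ht => h.timeDeriv_eq ht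
  have e2 : EqOn (timeDeriv (timeDeriv u)) (fun t => -v t - force B α (u t)) (Ici 0) := by
    intro t ht
    exact ((h.deriv_vel t ht).congr (fun s hs => e1 hs) (e1 ht)).derivWithin
      (uniqueDiffOn_Ici 0 t ht)
  refine ⟨?_, fun t ht => ?_⟩
  · rw [← one_add_one_eq_two, contDiffOn_succ_iff_derivWithin (uniqueDiffOn_Ici 0)]
    refine ⟨fun t ht => (h.deriv_pos t ht).differentiableWithinAt, by simp, ?_⟩
    rw [← zero_add (1 : WithTop ℕ∞), contDiffOn_succ_iff_derivWithin (uniqueDiffOn_Ici 0)]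
    refine ⟨fun t ht => ?_, by simp, ?_⟩
    · exact ((h.deriv_vel t ht).congr (fun s hs => e1 hs) (e1 ht)).differentiableWithinAt
    · rw [contDiffOn_zero]
      refine ContinuousOn.congr ?_ e2
      exact h.continuousOn_vel.neg.sub
        ((continuous_force hα).comp_continuousOn h.continuousOn_pos)
  · rw [e2 ht, e1 ht, norm_sqrtOp_rpow hs hm hc]
    change -v t - force B α (u t) + v t + force B α (u t) = 0
    abel

theorem norm_phaseField_sub_le {E : Type*} [NormedAddCommGroup E] {g : E → E} {K : ℝ}
    (hK : 0 ≤ K) {p q : E × E}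
    (hg : ‖g p.1 - g q.1‖ ≤ K * ‖p.1 - q.1‖) :
    ‖((p.2, -p.2 - g p.1) : E × E) - (q.2, -q.2 - g q.1)‖ ≤ (1 + K) * ‖p - q‖ := by
  have h1 : ‖p.1 - q.1‖ ≤ ‖p - q‖ := norm_fst_le (p - q)
  have h2 : ‖p.2 - q.2‖ ≤ ‖p - q‖ := norm_snd_le (p - q)
  have h3 : 0 ≤ ‖p - q‖ := norm_nonneg _
  refine (Prod.norm_mk _ _).le.trans (max_le ?_ ?_)
  · change ‖p.2 - q.2‖ ≤ _
    nlinarith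
  · have e : -p.2 - g p.1 - (-q.2 - g q.1) = -(p.2 - q.2) - (g p.1 - g q.1) := by abel
    change ‖-p.2 - g p.1 - (-q.2 - g q.1)‖ ≤ _
    rw [e]
    refine (norm_sub_le _ _).trans ?_
    rw [norm_neg]
    nlinarith

theorem exists_isPhaseCurve_of_lipschitz [CompleteSpace H] {g : H → H} {K : ℝ} (hK : 0 ≤ K)
    (hg : ∀ x y, ‖g x - g y‖ ≤ K * ‖x - y‖) (hg0 : g 0 = 0) (u₀ u₁ : H) :
    ∃ u v : ℝ → H, IsPhaseCurve g u v ∧ u 0 = u₀ ∧ v 0 = u₁ := by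
  obtain ⟨x, hx0, hx⟩ := exists_solution_of_lipschitz (E := H × H)
    (G := fun p => (p.2, -p.2 - g p.1)) (K := 1 + K) (by positivity)
    (fun p q => norm_phaseField_sub_le hK (hg _ _)) (by simp [hg0]) (u₀, u₁)
  refine ⟨fun t => (x t).1, fun t => (x t).2, ⟨fun t ht => ?_, fun t ht => ?_⟩, by simp [hx0],
    by simp [hx0]⟩
  · exact (ContinuousLinearMap.fst ℝ H H).hasFDerivAt.comp_hasDerivWithinAt t (hx t ht)
  · exact (ContinuousLinearMap.snd ℝ H H).hasFDerivAt.comp_hasDerivWithinAt t (hx t ht)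

/-- Two phase curves that meet at one time coincide at all times, earlier ones included. -/
theorem IsPhaseCurve.eq_of_eq_at [CompleteSpace H] {B : H →L[ℝ] H} {m : ℝ} (hs : B.IsSymmetric)
    (hm : 0 < m) (hc : ∀ x, m * ‖x‖ ^ 2 ≤ ⟪B x, x⟫_ℝ) {α : ℝ} (hα : 0 < α)
    {u v u' v' : ℝ → H} (h : IsPhaseCurve (force B α) u v) (h' : IsPhaseCurve (force B α) u' v')
    {t₀ : ℝ} (ht₀ : 0 ≤ t₀) (hu : u t₀ = u' t₀) (hv : v t₀ = v' t₀) {t : ℝ} (ht : 0 ≤ t) :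
    u t = u' t := by
  set T := max t t₀ with hT
  have hsub : Icc 0 T ⊆ Ici 0 := Icc_subset_Ici_self
  have hbd : ∀ {w z : ℝ → H}, IsPhaseCurve (force B α) w z →
      ∃ C, ∀ s ∈ Icc 0 T, ‖sqrtOp B (w s)‖ ≤ C := fun hw =>
    isCompact_Icc.exists_bound_of_continuousOn
      ((sqrtOp B).continuous.comp_continuousOn (hw.continuousOn_pos.mono hsub))
  obtain ⟨C, hC⟩ := hbd h
  obtain ⟨C', hC'⟩ := hbd h'
  set R := max 0 (max C C') with hR
  have hR0 : 0 ≤ R := le_max_left _ _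
  have hCR : C ≤ R := (le_max_left _ _).trans (le_max_right _ _)
  have hCR' : C' ≤ R := (le_max_right _ _).trans (le_max_right _ _)
  set K : ℝ := R ^ (2 * α) * (‖B‖ + 2 * α * ‖sqrtOp B‖ ^ 2) with hKdef
  have hK : 0 ≤ K := mul_nonneg (Real.rpow_nonneg hR0 _) (by positivity)
  let V : ℝ → H × H → H × H := fun _ p => (p.2, -p.2 - truncForce B α R p.1)
  have hV : ∀ s, LipschitzOnWith ⟨1 + K, by positivity⟩ (V s) univ := fun s =>
    (LipschitzWith.of_dist_le_mul fun p q => by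
      rw [dist_eq_norm, dist_eq_norm]
      exact norm_phaseField_sub_le hK
        (norm_truncForce_sub_le hs hm hc hα hR0 p.1 q.1)).lipschitzOnWith
  have hd : ∀ {w z : ℝ → H}, IsPhaseCurve (force B α) w z →
      (∀ s ∈ Icc 0 T, ‖sqrtOp B (w s)‖ ≤ R) → ∀ s ∈ Icc 0 T,
      HasDerivWithinAt (fun r => (w r, z r)) (V s (w s, z s)) (Ici 0) s := by
    intro w z hw hb s hs'
    have h1 := (hw.deriv_pos s hs'.1).prodMk (hw.deriv_vel s hs'.1)
    simpa only [V, truncForce_eq_force hs hm hc (hb s hs')] using h1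
  have hb1 : ∀ s ∈ Icc 0 T, ‖sqrtOp B (u s)‖ ≤ R := fun s hs => (hC s hs).trans hCR
  have hb2 : ∀ s ∈ Icc 0 T, ‖sqrtOp B (u' s)‖ ≤ R := fun s hs => (hC' s hs).trans hCR'
  have hco : ∀ {w z : ℝ → H}, IsPhaseCurve (force B α) w z →
      ContinuousOn (fun r => (w r, z r)) (Ici 0) := fun hw =>
    hw.continuousOn_pos.prodMk hw.continuousOn_vel
  have heq : (fun r => (u r, v r)) t₀ = (fun r => (u' r, v' r)) t₀ := by simp [hu, hv]
  have htT : t ≤ T := le_max_left _ _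
  have ht₀T : t₀ ≤ T := le_max_right _ _
  rcases le_total t₀ t with htt | htt
  · have hR' : ∀ s ∈ Ico t₀ T, s ∈ Icc 0 T := fun s hs => ⟨ht₀.trans hs.1, hs.2.le⟩
    have := ODE_solution_unique_of_mem_Icc_right (a := t₀) (b := T) (s := fun _ => univ)
      (fun s _ => hV s)
      ((hco h).mono fun s hs => ht₀.trans hs.1)
      (fun s hs => (hd h hb1 s (hR' s hs)).mono (Ici_subset_Ici.2 (ht₀.trans hs.1)))
      (fun _ _ => mem_univ _)
      ((hco h').mono fun s hs => ht₀.trans hs.1)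
      (fun s hs => (hd h' hb2 s (hR' s hs)).mono (Ici_subset_Ici.2 (ht₀.trans hs.1)))
      (fun _ _ => mem_univ _) heq ⟨htt, htT⟩
    exact congrArg Prod.fst this
  · have hR' : ∀ s ∈ Ioc 0 t₀, s ∈ Icc 0 T := fun s hs => ⟨hs.1.le, hs.2.trans ht₀T⟩
    have := ODE_solution_unique_of_mem_Icc_left (a := 0) (b := t₀) (s := fun _ => univ)
      (fun s _ => hV s)
      ((hco h).mono fun s hs => hs.1)
      (fun s hs => ((hd h hb1 s (hR' s hs)).hasDerivAt (Ici_mem_nhds hs.1)).hasDerivWithinAt)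
      (fun _ _ => mem_univ _)
      ((hco h').mono fun s hs => hs.1)
      (fun s hs => ((hd h' hb2 s (hR' s hs)).hasDerivAt (Ici_mem_nhds hs.1)).hasDerivWithinAt)
      (fun _ _ => mem_univ _) heq ⟨ht, htt⟩
    exact congrArg Prod.fst this

/-! ### The energy: global existence and decay -/

/-- The energy `|y|² + |B^{1/2} x|^{2α+2} / (α+1)` of the state with position `x` and
velocity `y`. -/
noncomputable def energy (B : H →L[ℝ] H) (α : ℝ) (x y : H) : ℝ :=
  ‖y‖ ^ 2 + ⟪B x, x⟫_ℝ ^ (α + 1) / (α + 1)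

theorem inner_force (B : H →L[ℝ] H) (α : ℝ) (x y : H) :
    ⟪force B α x, y⟫_ℝ = ⟪B x, x⟫_ℝ ^ α * ⟪B x, y⟫_ℝ := real_inner_smul_left _ _ _

theorem inner_force_self {B : H →L[ℝ] H} {m : ℝ} (hm : 0 < m)
    (hc : ∀ x, m * ‖x‖ ^ 2 ≤ ⟪B x, x⟫_ℝ) {α : ℝ} (hα : 0 < α) (x : H) :
    ⟪force B α x, x⟫_ℝ = ⟪B x, x⟫_ℝ ^ (α + 1) := by
  rw [inner_force, Real.rpow_add_of_nonneg (inner_self_nonneg_of_coercive hm hc x) hα.le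
    zero_le_one, Real.rpow_one]

theorem norm_sq_le_energy {B : H →L[ℝ] H} {m : ℝ} (hm : 0 < m)
    (hc : ∀ x, m * ‖x‖ ^ 2 ≤ ⟪B x, x⟫_ℝ) {α : ℝ} (hα : 0 < α) (x y : H) :
    ‖y‖ ^ 2 ≤ energy B α x y := by
  have := Real.rpow_nonneg (inner_self_nonneg_of_coercive hm hc x) (α + 1)
  have h2 : 0 ≤ ⟪B x, x⟫_ℝ ^ (α + 1) / (α + 1) := by positivity
  rw [energy]; linarith

theorem energy_nonneg {B : H →L[ℝ] H} {m : ℝ} (hm : 0 < m)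
    (hc : ∀ x, m * ‖x‖ ^ 2 ≤ ⟪B x, x⟫_ℝ) {α : ℝ} (hα : 0 < α) (x y : H) :
    0 ≤ energy B α x y :=
  (sq_nonneg _).trans (norm_sq_le_energy hm hc hα x y)

theorem rpow_le_of_energy_le {B : H →L[ℝ] H} {α M : ℝ} (hα : 0 < α) {x y : H}
    (h : energy B α x y ≤ M) : ⟪B x, x⟫_ℝ ^ (α + 1) ≤ (α + 1) * M := by
  have h1 : ⟪B x, x⟫_ℝ ^ (α + 1) / (α + 1) ≤ M := by
    rw [energy] at h
    nlinarith [sq_nonneg ‖y‖]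
  rwa [div_le_iff₀' (by positivity)] at h1

theorem norm_sqrtOp_le_of_energy_le [CompleteSpace H] {B : H →L[ℝ] H} {m : ℝ}
    (hs : B.IsSymmetric) (hm : 0 < m) (hc : ∀ x, m * ‖x‖ ^ 2 ≤ ⟪B x, x⟫_ℝ) {α M R : ℝ}
    (hα : 0 < α) (hR : 1 ≤ R) (hMR : (α + 1) * M ≤ R) {x y : H} (h : energy B α x y ≤ M) :
    ‖sqrtOp B x‖ ≤ R := by
  by_contra! hlt
  have h1 := (rpow_le_of_energy_le hα h).trans hMR
  rw [← norm_sqrtOp_sq hs hm hc] at h1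
  have h2 : ‖sqrtOp B x‖ ≤ ‖sqrtOp B x‖ ^ 2 := by nlinarith
  have h3 : (‖sqrtOp B x‖ ^ 2) ^ (1 : ℝ) ≤ (‖sqrtOp B x‖ ^ 2) ^ (α + 1) :=
    Real.rpow_le_rpow_of_exponent_le (by linarith) (by linarith)
  rw [Real.rpow_one] at h3
  linarith

theorem exists_norm_force_le_of_energy_le {B : H →L[ℝ] H} {m : ℝ} (hm : 0 < m)
    (hc : ∀ x, m * ‖x‖ ^ 2 ≤ ⟪B x, x⟫_ℝ) {α η : ℝ} (hα : 0 < α) (hη : 0 < η) :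
    ∃ δ, 0 < δ ∧ ∀ x y, energy B α x y ≤ δ → ‖force B α x‖ ≤ η * ‖x‖ := by
  set θ : ℝ := η / (‖B‖ + 1) with hθ
  have hθ0 : 0 < θ := by positivity
  have hpos : 0 < θ ^ ((α + 1) / α) := Real.rpow_pos_of_pos hθ0 _
  refine ⟨θ ^ ((α + 1) / α) / (α + 1), by positivity, fun x y h => ?_⟩
  have h0 := inner_self_nonneg_of_coercive hm hc x
  have h1 := rpow_le_of_energy_le hα h
  rw [mul_div_cancel₀ _ (by positivity)] at h1
  have hq0 : 0 ≤ ⟪B x, x⟫_ℝ ^ α := Real.rpow_nonneg h0 _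
  have h2 : ⟪B x, x⟫_ℝ ^ α ≤ θ := by
    by_contra! hlt
    have h3 := Real.rpow_lt_rpow hθ0.le hlt (z := (α + 1) / α) (by positivity)
    rw [← Real.rpow_mul h0, mul_div_cancel₀ _ hα.ne'] at h3
    linarith
  rw [force, norm_smul, Real.norm_of_nonneg hq0]
  calc _ ≤ θ * (‖B‖ * ‖x‖) := by gcongr; exact B.le_opNorm x
    _ ≤ θ * ((‖B‖ + 1) * ‖x‖) := by gcongr; linarith
    _ = η * ‖x‖ := by rw [hθ]; field_simp

theorem hasDerivWithinAt_energy {B : H →L[ℝ] H} (hs : B.IsSymmetric) {α : ℝ} (hα : 0 < α)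
    {u v : ℝ → H} {u' v' : H} {s : Set ℝ} {t : ℝ} (hu : HasDerivWithinAt u u' s t)
    (hv : HasDerivWithinAt v v' s t) :
    HasDerivWithinAt (fun r => energy B α (u r) (v r))
      (2 * ⟪v t, v'⟫_ℝ + 2 * ⟪force B α (u t), u'⟫_ℝ) s t := by
  have h1 : HasDerivWithinAt (fun r => B (u r)) (B u') s t :=
    B.hasFDerivAt.comp_hasDerivWithinAt t hu
  have h2 : HasDerivWithinAt (fun r => ⟪B (u r), u r⟫_ℝ) (2 * ⟪B (u t), u'⟫_ℝ) s t := by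
    refine (h1.inner ℝ hu).congr_deriv ?_
    have : ⟪B u', u t⟫_ℝ = ⟪B (u t), u'⟫_ℝ := by
      rw [real_inner_comm]
      exact (hs (u t) u').symm
    rw [this]; ring
  have h3 := (h2.rpow_const (p := α + 1) (Or.inr (by linarith))).div_const (α + 1)
  refine (hv.norm_sq.add h3).congr_deriv ?_
  rw [inner_force, add_sub_cancel_right]
  field_simp

theorem exists_isPhaseCurve [CompleteSpace H] {B : H →L[ℝ] H} {m : ℝ}
    (hs : B.IsSymmetric) (hm : 0 < m) (hc : ∀ x, m * ‖x‖ ^ 2 ≤ ⟪B x, x⟫_ℝ) {α : ℝ}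
    (hα : 0 < α) (u₀ u₁ : H) :
    ∃ u v : ℝ → H, IsPhaseCurve (force B α) u v ∧ u 0 = u₀ ∧ v 0 = u₁ := by
  set E₀ := energy B α u₀ u₁ with hE₀
  have hE₀0 : 0 ≤ E₀ := energy_nonneg hm hc hα _ _
  set R := (α + 1) * (E₀ + 1) with hR
  have hR1 : 1 ≤ R := by nlinarith
  have hR0 : 0 ≤ R := by linarith
  obtain ⟨u, v, h, hu0, hv0⟩ := exists_isPhaseCurve_of_lipschitz (g := truncForce B α R)
    (mul_nonneg (Real.rpow_nonneg hR0 _) (by positivity))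
    (norm_truncForce_sub_le hs hm hc hα hR0) (truncForce_zero B α R) u₀ u₁
  have hle : ∀ {t}, energy B α (u t) (v t) ≤ E₀ + 1 → ‖sqrtOp B (u t)‖ ≤ R :=
    fun ht => norm_sqrtOp_le_of_energy_le hs hm hc hα hR1 le_rfl ht
  -- The energy cannot cross the line `E₀ + (1 + s) / (1 + t)` on `[0, t]`: below `E₀ + 1` the
  -- truncation is inactive, and there the energy does not increase.
  have hbd : ∀ t, 0 ≤ t → ‖sqrtOp B (u t)‖ ≤ R := by
    intro t ht
    have hder : ∀ s, 0 ≤ s → HasDerivWithinAt (fun r => energy B α (u r) (v r)) _ (Ici 0) s :=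
      fun s hs' => hasDerivWithinAt_energy hs hα (h.deriv_pos s hs') (h.deriv_vel s hs')
    have hfence := image_le_of_deriv_right_lt_deriv_boundary (a := 0) (b := t)
      (B := fun s => E₀ + (1 + s) / (1 + t)) (B' := fun _ => 1 / (1 + t))
      (fun s hs' => (hder s hs'.1).continuousWithinAt.mono Icc_subset_Ici_self)
      (fun s hs' => (hder s hs'.1).mono (Ici_subset_Ici.2 hs'.1))
      (by
        simp only [hu0, hv0, ← hE₀]
        have : 0 ≤ (1 + (0 : ℝ)) / (1 + t) := by positivity
        linarith)
      (fun s => (((hasDerivAt_id s).const_add 1).div_const (1 + t)).const_add E₀)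
      (fun s hs' heq => ?_) (right_mem_Icc.2 ht)
    · have h1 : (1 + t) / (1 + t) = 1 := div_self (by positivity)
      simp only [h1] at hfence
      exact hle hfence
    · have h1 : (1 + s) / (1 + t) ≤ 1 := by
        rw [div_le_one (by positivity)]
        linarith [hs'.2]
      have h2 : ‖sqrtOp B (u s)‖ ≤ R := hle (by rw [heq]; linarith)
      rw [truncForce_eq_force hs hm hc h2, inner_sub_right, inner_neg_right,
        real_inner_self_eq_norm_sq, real_inner_comm (v s)]
      have h3 : 0 < 1 / (1 + t) := by positivity
      nlinarith [sq_nonneg ‖v s‖]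
  refine ⟨u, v, ⟨h.deriv_pos, fun t ht => ?_⟩, hu0, hv0⟩
  have := h.deriv_vel t ht
  rwa [truncForce_eq_force hs hm hc (hbd t ht)] at this

theorem IsPhaseCurve.energy_deriv {B : H →L[ℝ] H} (hs : B.IsSymmetric) {α : ℝ} (hα : 0 < α)
    {u v : ℝ → H} (h : IsPhaseCurve (force B α) u v) {t : ℝ} (ht : 0 ≤ t) :
    HasDerivWithinAt (fun r => energy B α (u r) (v r)) (-2 * ‖v t‖ ^ 2) (Ici 0) t := by
  refine (hasDerivWithinAt_energy hs hα (h.deriv_pos t ht) (h.deriv_vel t ht)).congr_deriv ?_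
  rw [inner_sub_right, inner_neg_right, real_inner_self_eq_norm_sq, real_inner_comm (v t)]
  ring

theorem IsPhaseCurve.energy_le {B : H →L[ℝ] H} (hs : B.IsSymmetric) {α : ℝ} (hα : 0 < α)
    {u v : ℝ → H} (h : IsPhaseCurve (force B α) u v) {t : ℝ} (ht : 0 ≤ t) :
    energy B α (u t) (v t) ≤ energy B α (u 0) (v 0) :=
  le_of_hasDerivWithinAt_nonpos (y := fun r => energy B α (u r) (v r))
    (fun _ hr => h.energy_deriv hs hα hr) (fun r _ => by nlinarith [sq_nonneg ‖v r‖]) ht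

/-- With `P = E + ⟪u, v⟫ + |u|²/2`, which is nonnegative and satisfies `P' ≤ -E`, the function
`P + t E` is nonincreasing; hence `t E(t) ≤ P(0)`. -/
theorem IsPhaseCurve.tendsto_energy {B : H →L[ℝ] H} {m : ℝ}
    (hs : B.IsSymmetric) (hm : 0 < m) (hc : ∀ x, m * ‖x‖ ^ 2 ≤ ⟪B x, x⟫_ℝ) {α : ℝ} (hα : 0 < α)
    {u v : ℝ → H} (h : IsPhaseCurve (force B α) u v) :
    Tendsto (fun t => energy B α (u t) (v t)) atTop (𝓝 0) := by
  set P : ℝ → ℝ := fun t => energy B α (u t) (v t) + ⟪u t, v t⟫_ℝ + ‖u t‖ ^ 2 / 2 with hP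
  have hle : ∀ t, 0 ≤ t → t * energy B α (u t) (v t) ≤ P 0 := by
    intro t ht
    have hmono := le_of_hasDerivWithinAt_nonpos (T := 0)
      (y := fun r => P r + r * energy B α (u r) (v r))
      (fun r hr => by
        have hE := h.energy_deriv hs hα hr
        have hu := h.deriv_pos r hr
        have hv := h.deriv_vel r hr
        exact ((hE.add (hu.inner ℝ hv)).add (hu.norm_sq.div_const 2)).add
          ((hasDerivWithinAt_id r _).mul hE))
      (fun r hr => by
        have h1 := inner_force_self hm hc hα (u r)
        have h2 := Real.rpow_nonneg (inner_self_nonneg_of_coercive hm hc (u r)) (α + 1)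
        have h3 : ⟪B (u r), u r⟫_ℝ ^ (α + 1) / (α + 1) ≤ ⟪B (u r), u r⟫_ℝ ^ (α + 1) :=
          div_le_self h2 (by linarith)
        have h4 : 0 ≤ r * ‖v r‖ ^ 2 := mul_nonneg hr (sq_nonneg _)
        simp only [inner_sub_right, inner_neg_right, real_inner_self_eq_norm_sq,
          real_inner_comm (force B α (u r)) (u r), h1, energy, id]
        linarith) ht
    have hP0 : 0 ≤ P t := by
      have h1 := norm_sq_le_energy hm hc hα (u t) (v t)
      have h2 := (abs_le.1 (abs_real_inner_le_norm (u t) (v t))).1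
      simp only [hP]
      nlinarith [sq_nonneg (‖u t‖ - ‖v t‖)]
    simp only [zero_mul, add_zero] at hmono
    linarith
  refine squeeze_zero' (g := fun t => P 0 / t)
    (Eventually.of_forall fun t => energy_nonneg hm hc hα _ _) ?_
    (tendsto_const_nhds.div_atTop tendsto_id)
  filter_upwards [eventually_gt_atTop 0] with t ht
  rw [le_div_iff₀ ht, mul_comm]
  exact hle t ht.le

/-! ### The slow cone -/

theorem IsPhaseCurve.deriv_add {g : H → H} {u v : ℝ → H} (h : IsPhaseCurve g u v) {t : ℝ}
    (ht : 0 ≤ t) : HasDerivWithinAt (fun r => u r + v r) (-g (u t)) (Ici 0) t :=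
  ((h.deriv_pos t ht).add (h.deriv_vel t ht)).congr_deriv (by abel)

/-- The cone `|v| ≤ κ |u + v|` is forward invariant: on its boundary the stable component `v`
decays at rate almost `1`, while `u + v` is almost constant. -/
theorem IsPhaseCurve.cone_invariant {g : H → H} {u v : ℝ → H} (h : IsPhaseCurve g u v)
    {T κ η : ℝ} (hT : 0 ≤ T) (hκ : 0 < κ) (hκ' : κ ≤ 1 / 4) (hη : 0 < η)
    (hηκ : η * (1 + 1 / κ) ≤ 1 / 2) (hg : ∀ t, T ≤ t → ‖g (u t)‖ ≤ η * ‖u t‖)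
    (hne : ∀ t, 0 ≤ t → v t = 0 → u t ≠ 0) (hTc : ‖v T‖ ≤ κ * ‖u T + v T‖) {t : ℝ} (ht : T ≤ t) :
    ‖v t‖ ≤ κ * ‖u t + v t‖ := by
  have hder : ∀ s, 0 ≤ s → HasDerivWithinAt
      (fun r => ‖v r‖ ^ 2 - κ ^ 2 * ‖u r + v r‖ ^ 2) _ (Ici 0) s := fun s hs =>
    (h.deriv_vel s hs).norm_sq.sub ((h.deriv_add hs).norm_sq.const_mul (κ ^ 2))
  have hD := image_le_of_deriv_right_lt_deriv_boundary (a := T) (b := t)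
    (B := fun _ => (0 : ℝ)) (B' := fun _ => 0)
    (fun s hs => (hder s (hT.trans hs.1)).continuousWithinAt.mono fun r hr => hT.trans hr.1)
    (fun s hs => (hder s (hT.trans hs.1)).mono (Ici_subset_Ici.2 (hT.trans hs.1)))
    (by
      have := pow_le_pow_left₀ (norm_nonneg _) hTc 2
      rw [mul_pow] at this
      linarith)
    (fun s => hasDerivAt_const s 0)
    (fun s hs heq => ?_) (right_mem_Icc.2 ht)
  · have h1 : ‖v t‖ ^ 2 ≤ (κ * ‖u t + v t‖) ^ 2 := by rw [mul_pow]; linarith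
    exact le_of_sq_le_sq h1 (by positivity)
  · have h1 : ‖v s‖ = κ * ‖u s + v s‖ := by
      have h2 : ‖v s‖ ^ 2 = (κ * ‖u s + v s‖) ^ 2 := by rw [mul_pow]; linarith
      exact (pow_left_inj₀ (norm_nonneg _) (by positivity) two_ne_zero).1 h2
    have hs0 : 0 ≤ s := hT.trans hs.1
    have hv0 : 0 < ‖v s‖ := by
      rw [norm_pos_iff]
      intro h0
      have h2 : κ * ‖u s + v s‖ = 0 := by rw [← h1, h0, norm_zero]
      have h3 := (mul_eq_zero.1 h2).resolve_left hκ.ne'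
      rw [norm_eq_zero, h0, add_zero] at h3
      exact hne s hs0 h0 h3
    have hw : ‖u s + v s‖ = 1 / κ * ‖v s‖ := by rw [h1]; field_simp
    have hgs : ‖g (u s)‖ ≤ 1 / 2 * ‖v s‖ := by
      calc ‖g (u s)‖ ≤ η * ‖u s‖ := hg s hs.1
        _ ≤ η * (1 / κ * ‖v s‖ + ‖v s‖) := by
          rw [← hw]; gcongr; exact norm_le_add_norm_add _ _
        _ = η * (1 + 1 / κ) * ‖v s‖ := by ring
        _ ≤ _ := by gcongr
    have i1 := (abs_le.1 (abs_real_inner_le_norm (v s) (g (u s)))).1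
    have i2 := (abs_le.1 (abs_real_inner_le_norm (u s + v s) (g (u s)))).2
    have i3 : κ ^ 2 * ⟪u s + v s, g (u s)⟫_ℝ ≤ κ * (‖v s‖ * ‖g (u s)‖) := by
      calc _ ≤ κ ^ 2 * (‖u s + v s‖ * ‖g (u s)‖) := by gcongr
        _ = κ * ((κ * ‖u s + v s‖) * ‖g (u s)‖) := by ring
        _ = _ := by rw [← h1]
    have i4 : ‖v s‖ * ‖g (u s)‖ ≤ 1 / 2 * ‖v s‖ ^ 2 := by
      calc _ ≤ ‖v s‖ * (1 / 2 * ‖v s‖) := by gcongr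
        _ = _ := by ring
    have i5 : κ * (‖v s‖ * ‖g (u s)‖) ≤ 1 / 4 * (1 / 2 * ‖v s‖ ^ 2) := by gcongr
    rw [inner_sub_right, inner_neg_right, inner_neg_right, real_inner_self_eq_norm_sq]
    have : 0 < ‖v s‖ ^ 2 := by positivity
    linarith

/-- Comparison with `y' = -y^{1+α}`: the quantity `y^{-α}` grows linearly. -/
theorem exists_linear_bounds_rpow_neg {T α c C : ℝ} {y p : ℝ → ℝ} (hT : 0 ≤ T) (hα : 0 < α)
    (hc : 0 < c) (hC : 0 < C) (hy : ∀ t, T ≤ t → HasDerivWithinAt y (-p t) (Ici T) t)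
    (hpos : ∀ t, T ≤ t → 0 < y t) (hlo : ∀ t, T ≤ t → c * (y t ^ α * y t) ≤ p t)
    (hhi : ∀ t, T ≤ t → p t ≤ C * (y t ^ α * y t)) :
    ∃ a b : ℝ, 0 < a ∧ 0 < b ∧ ∀ t, T ≤ t →
      a * (1 + t) ≤ y t ^ (-α) ∧ y t ^ (-α) ≤ b * (1 + t) := by
  set z : ℝ → ℝ := fun t => y t ^ (-α) with hz
  have hzd : ∀ t, T ≤ t → HasDerivWithinAt z (α * (p t / (y t ^ α * y t))) (Ici T) t := by
    intro t ht
    have hp := hpos t ht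
    refine ((hy t ht).rpow_const (p := -α) (Or.inl hp.ne')).congr_deriv ?_
    have e : y t ^ (-α - 1) = (y t ^ α * y t)⁻¹ := by
      rw [Real.rpow_sub_one hp.ne', Real.rpow_neg hp.le, mul_inv, div_eq_mul_inv]
    rw [e]; ring
  have hzpos : 0 < z T := Real.rpow_pos_of_pos (hpos T le_rfl) _
  have hratio : ∀ t, T ≤ t → c ≤ p t / (y t ^ α * y t) ∧ p t / (y t ^ α * y t) ≤ C := by
    intro t ht
    have hp := hpos t ht
    have : 0 < y t ^ α * y t := mul_pos (Real.rpow_pos_of_pos hp _) hp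
    exact ⟨(le_div_iff₀ this).2 (hlo t ht), (div_le_iff₀ this).2 (hhi t ht)⟩
  have hup : ∀ t, T ≤ t → z t ≤ z T + α * C * (t - T) := by
    intro t ht
    have := le_of_hasDerivWithinAt_nonpos (T := T) (y := fun r => z r - α * C * (r - T))
      (fun r hr => (hzd r hr).sub (((hasDerivWithinAt_id r _).sub_const T).const_mul (α * C)))
      (fun r hr => by nlinarith [mul_le_mul_of_nonneg_left (hratio r hr).2 hα.le]) ht
    simp only [sub_self, mul_zero, sub_zero] at this
    linarith
  have hdn : ∀ t, T ≤ t → z T + α * c * (t - T) ≤ z t := by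
    intro t ht
    have := le_of_hasDerivWithinAt_nonpos (T := T) (y := fun r => α * c * (r - T) - z r)
      (fun r hr => (((hasDerivWithinAt_id r _).sub_const T).const_mul (α * c)).sub (hzd r hr))
      (fun r hr => by nlinarith [mul_le_mul_of_nonneg_left (hratio r hr).1 hα.le]) ht
    simp only [sub_self, mul_zero] at this
    linarith
  refine ⟨min (z T / (1 + T)) (α * c), z T + α * C, lt_min (by positivity) (by positivity),
    by positivity, fun t ht => ⟨?_, ?_⟩⟩
  · refine le_trans ?_ (hdn t ht)
    have h1 : min (z T / (1 + T)) (α * c) * (1 + T) ≤ z T := by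
      calc _ ≤ z T / (1 + T) * (1 + T) := by gcongr; exact min_le_left _ _
        _ = z T := by field_simp
    have h2 : min (z T / (1 + T)) (α * c) * (t - T) ≤ α * c * (t - T) :=
      mul_le_mul_of_nonneg_right (min_le_right _ _) (by linarith)
    linarith
  · refine (hup t ht).trans ?_
    have h1 : 0 ≤ α * C := by positivity
    have h2 : 0 ≤ z T * t := mul_nonneg hzpos.le (hT.trans ht)
    nlinarith

/-- Aperture of the slow cone: small enough for `B` to remain coercive between `u + v` and `u`. -/
noncomputable def coneAperture (B : H →L[ℝ] H) (m : ℝ) : ℝ := m / (4 * (‖B‖ + m))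

theorem coneAperture_pos (B : H →L[ℝ] H) {m : ℝ} (hm : 0 < m) : 0 < coneAperture B m := by
  unfold coneAperture; positivity

theorem coneAperture_le (B : H →L[ℝ] H) {m : ℝ} (hm : 0 < m) : coneAperture B m ≤ 1 / 4 := by
  unfold coneAperture
  rw [div_le_div_iff₀ (by positivity) (by positivity)]
  linarith [norm_nonneg B]

theorem norm_mul_coneAperture_le (B : H →L[ℝ] H) {m : ℝ} (hm : 0 < m) :
    ‖B‖ * coneAperture B m ≤ m / 4 := by
  unfold coneAperture
  rw [mul_div_assoc', div_le_div_iff₀ (by positivity) (by positivity)]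
  nlinarith [norm_nonneg B]

/-- In the slow cone `u + v` is close to `u`, so that `(u + v)' = -force` gives
`(|u + v|²)' ≈ -|u + v|^{2α+2}`. -/
theorem IsPhaseCurve.exists_bounds_of_cone {B : H →L[ℝ] H} {m : ℝ}
    (hm : 0 < m) (hc : ∀ x, m * ‖x‖ ^ 2 ≤ ⟪B x, x⟫_ℝ) {α : ℝ} (hα : 0 < α)
    {u v : ℝ → H} (h : IsPhaseCurve (force B α) u v) {T : ℝ} (hT : 0 ≤ T)
    (hne : ∀ t, 0 ≤ t → v t = 0 → u t ≠ 0)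
    (hcone : ∀ t, T ≤ t → ‖v t‖ ≤ coneAperture B m * ‖u t + v t‖) :
    ∃ C₁ C₂ : ℝ, 0 < C₁ ∧ 0 < C₂ ∧ ∀ t, T ≤ t →
      C₁ / (1 + t) ^ (1 / (2 * α)) ≤ ‖u t‖ ∧ ‖u t‖ ≤ C₂ / (1 + t) ^ (1 / (2 * α)) := by
  set κ := coneAperture B m with hκdef
  have hκ : 0 < κ := coneAperture_pos B hm
  have hκ4 : κ ≤ 1 / 4 := coneAperture_le B hm
  have hκB : ‖B‖ * κ ≤ m / 4 := norm_mul_coneAperture_le B hm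
  have hv4 : ∀ t, T ≤ t → ‖v t‖ ≤ 1 / 4 * ‖u t + v t‖ := fun t ht =>
    (hcone t ht).trans (by gcongr)
  have hup : ∀ t, T ≤ t → ‖u t‖ ≤ 2 * ‖u t + v t‖ := fun t ht => by
    linarith [norm_le_add_norm_add (u t) (v t), hv4 t ht, norm_nonneg (u t + v t)]
  have hdn : ∀ t, T ≤ t → 3 / 4 * ‖u t + v t‖ ≤ ‖u t‖ := fun t ht => by
    linarith [norm_add_le (u t) (v t), hv4 t ht]
  have hwpos : ∀ t, T ≤ t → 0 < ‖u t + v t‖ := by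
    intro t ht
    by_contra! h0
    have h1 : v t = 0 := norm_le_zero_iff.1 ((hv4 t ht).trans (by linarith))
    have h2 : u t = 0 := norm_le_zero_iff.1 ((hup t ht).trans (by linarith))
    exact hne t (hT.trans ht) h1 h2
  set C : ℝ := 2 * (‖B‖ ^ α * ‖B‖ * 2 ^ (2 * α) * 2) + 1 with hCdef
  have hBα : 0 ≤ ‖B‖ ^ α := Real.rpow_nonneg (norm_nonneg _) _
  have hC : 0 < C := by positivity
  set c : ℝ := 2 * ((m / 2) ^ α * (m / 4)) with hcdef
  have hcpos : 0 < c := by positivity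
  obtain ⟨a, b, ha, hb, hab⟩ := exists_linear_bounds_rpow_neg (T := T) (α := α) (c := c) (C := C)
    (y := fun t => ‖u t + v t‖ ^ 2) (p := fun t => 2 * ⟪u t + v t, force B α (u t)⟫_ℝ)
    hT hα hcpos hC
    (fun t ht => (((h.deriv_add (hT.trans ht)).norm_sq).mono (Ici_subset_Ici.2 hT)).congr_deriv
      (by rw [inner_neg_right]; ring))
    (fun t ht => pow_pos (hwpos t ht) 2)
    (fun t ht => by
      have hw := hwpos t ht
      have hq : m / 2 * ‖u t + v t‖ ^ 2 ≤ ⟪B (u t), u t⟫_ℝ := by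
        refine le_trans ?_ (hc (u t))
        have h1 := pow_le_pow_left₀ (by positivity) (hdn t ht) 2
        rw [mul_pow] at h1
        nlinarith [sq_nonneg ‖u t + v t‖]
      have hqα : (m / 2) ^ α * (‖u t + v t‖ ^ 2) ^ α ≤ ⟪B (u t), u t⟫_ℝ ^ α := by
        rw [← Real.mul_rpow (by positivity) (by positivity)]
        exact Real.rpow_le_rpow (by positivity) hq hα.le
      have hin : m / 4 * ‖u t + v t‖ ^ 2 ≤ ⟪u t + v t, B (u t)⟫_ℝ := by
        rw [inner_add_left, real_inner_comm (B (u t)) (u t)]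
        have h1 := (abs_le.1 (abs_real_inner_le_norm (v t) (B (u t)))).1
        have h2 : ‖v t‖ * ‖B (u t)‖ ≤ m / 3 * ‖u t‖ ^ 2 := by
          have h3 : ‖u t + v t‖ ≤ 4 / 3 * ‖u t‖ := by linarith [hdn t ht]
          calc _ ≤ (κ * (4 / 3 * ‖u t‖)) * (‖B‖ * ‖u t‖) := by
                gcongr
                · exact (hcone t ht).trans (by gcongr)
                · exact B.le_opNorm _
            _ = 4 / 3 * (‖B‖ * κ) * ‖u t‖ ^ 2 := by ring
            _ ≤ 4 / 3 * (m / 4) * ‖u t‖ ^ 2 := by gcongr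
            _ = _ := by ring
        have h4 := hc (u t)
        have h5 := pow_le_pow_left₀ (by positivity) (hdn t ht) 2
        rw [mul_pow] at h5
        nlinarith [sq_nonneg ‖u t + v t‖]
      have e : ⟪u t + v t, force B α (u t)⟫_ℝ
          = ⟪B (u t), u t⟫_ℝ ^ α * ⟪u t + v t, B (u t)⟫_ℝ := real_inner_smul_right _ _ _
      simp only [e, hcdef]
      have h6 := mul_le_mul hqα hin (by positivity) (Real.rpow_nonneg
        (inner_self_nonneg_of_coercive hm hc (u t)) _)
      linarith)
    (fun t ht => by
      have hw := hwpos t ht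
      have h1 := real_inner_le_norm (u t + v t) (force B α (u t))
      have e : (2 * ‖u t + v t‖) ^ (2 * α) = 2 ^ (2 * α) * (‖u t + v t‖ ^ 2) ^ α := by
        rw [Real.mul_rpow (by positivity) (by positivity), Real.rpow_mul hw.le, Real.rpow_two]
      have h2 : ‖force B α (u t)‖
          ≤ ‖B‖ ^ α * ‖B‖ * (2 ^ (2 * α) * (‖u t + v t‖ ^ 2) ^ α) * (2 * ‖u t + v t‖) := by
        refine (norm_force_le hm hc hα (u t)).trans ?_
        rw [← e]
        have := hup t ht
        gcongr
      have h3 := mul_le_mul_of_nonneg_left h2 hw.le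
      have h4 : 0 ≤ (‖u t + v t‖ ^ 2) ^ α * ‖u t + v t‖ ^ 2 := by positivity
      simp only [hCdef]
      nlinarith)
  have hp : 0 < 1 / (2 * α) := by positivity
  have hwz : ∀ t, T ≤ t → ‖u t + v t‖ = ((‖u t + v t‖ ^ 2) ^ (-α)) ^ (-(1 / (2 * α))) := by
    intro t ht
    have hw := hwpos t ht
    rw [← Real.rpow_mul (by positivity), ← Real.rpow_two, ← Real.rpow_mul hw.le]
    have : (2 : ℝ) * (-α * -(1 / (2 * α))) = 1 := by field_simp
    rw [this, Real.rpow_one]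
  have hsplit : ∀ t, T ≤ t → ∀ d : ℝ, 0 < d →
      (d * (1 + t)) ^ (-(1 / (2 * α))) = d ^ (-(1 / (2 * α))) / (1 + t) ^ (1 / (2 * α)) := by
    intro t ht d hd
    have h0 : 0 ≤ 1 + t := by linarith
    rw [Real.mul_rpow hd.le h0, Real.rpow_neg h0, ← div_eq_mul_inv]
  refine ⟨3 / 4 * b ^ (-(1 / (2 * α))), 2 * a ^ (-(1 / (2 * α))), by positivity, by positivity,
    fun t ht => ⟨?_, ?_⟩⟩
  · refine le_trans ?_ (hdn t ht)
    rw [mul_div_assoc, ← hsplit t ht b hb]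
    refine mul_le_mul_of_nonneg_left ?_ (by norm_num)
    rw [hwz t ht]
    exact Real.rpow_le_rpow_of_nonpos (Real.rpow_pos_of_pos (pow_pos (hwpos t ht) 2) _)
      (hab t ht).2 (by linarith)
  · refine (hup t ht).trans ?_
    rw [mul_div_assoc, ← hsplit t ht a ha]
    refine mul_le_mul_of_nonneg_left ?_ (by norm_num)
    rw [hwz t ht]
    exact Real.rpow_le_rpow_of_nonpos (mul_pos ha (by linarith)) (hab t ht).1 (by linarith)

theorem isSlowFrom_of_bounds {α T : ℝ} {u : ℝ → H} (hα : 0 < α) (hT : 0 ≤ T)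
    (hu : ContinuousOn u (Ici 0)) {C₁ C₂ : ℝ} (hC₁ : 0 < C₁) (hC₂ : 0 < C₂)
    (hb : ∀ t, T ≤ t → C₁ / (1 + t) ^ (1 / (2 * α)) ≤ ‖u t‖ ∧
      ‖u t‖ ≤ C₂ / (1 + t) ^ (1 / (2 * α))) : IsSlowFrom α T u := by
  obtain ⟨M, hM⟩ := isCompact_Icc.exists_bound_of_continuousOn
    (hu.mono (Icc_subset_Ici_self : Icc 0 T ⊆ Ici 0))
  have hM0 : 0 ≤ M := (norm_nonneg _).trans (hM 0 ⟨le_rfl, hT⟩)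
  have hp : 0 ≤ 1 / (2 * α) := by positivity
  refine ⟨C₁, C₂ + M * (1 + T) ^ (1 / (2 * α)), hC₁, by positivity, fun t ht => (hb t ht).1,
    fun t ht => ?_⟩
  have h1 : 0 < (1 + t) ^ (1 / (2 * α)) := by positivity
  rcases le_total T t with h | h
  · refine (hb t h).2.trans ?_
    gcongr
    have : 0 ≤ M * (1 + T) ^ (1 / (2 * α)) := by positivity
    linarith
  · refine (hM t ⟨ht, h⟩).trans ?_
    rw [le_div_iff₀ h1]
    have : M * (1 + t) ^ (1 / (2 * α)) ≤ M * (1 + T) ^ (1 / (2 * α)) := by gcongr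
    linarith

/-! ### The fast regime -/

theorem rpow_mul_self_le_exp {α A b x t : ℝ} (hα : 0 < α) (hx : 0 ≤ x)
    (h : x ≤ A * Real.exp (-(b * t))) :
    x ^ (2 * α) * x ≤ A ^ (2 * α) * A * Real.exp (-((1 + 2 * α) * b * t)) := by
  have hA : 0 ≤ A := nonneg_of_mul_nonneg_left (hx.trans h) (Real.exp_pos _)
  have h1 : x ^ (2 * α) ≤ A ^ (2 * α) * Real.exp (-(b * t) * (2 * α)) := by
    rw [Real.exp_mul, ← Real.mul_rpow hA (Real.exp_pos _).le]
    exact Real.rpow_le_rpow hx h (by positivity)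
  calc _ ≤ (A ^ (2 * α) * Real.exp (-(b * t) * (2 * α))) * (A * Real.exp (-(b * t))) := by
        gcongr
    _ = A ^ (2 * α) * A * (Real.exp (-(b * t) * (2 * α)) * Real.exp (-(b * t))) := by ring
    _ = _ := by
        rw [← Real.exp_add]
        ring_nf

theorem hasFastProfile_of_le {α T C : ℝ} {u v : ℝ → H} {v₀ : H} (hT : 0 ≤ T)
    (hv : ∀ t, 0 ≤ t → timeDeriv u t = v t)
    (hle : ∀ t, T ≤ t → ‖v t + Real.exp (-t) • v₀‖ + ‖u t - Real.exp (-t) • v₀‖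
      ≤ C * Real.exp (-((1 + 2 * α) * t))) : HasFastProfile α v₀ u := by
  intro γ hγ
  have hlim : Tendsto (fun t : ℝ => C * Real.exp (-((1 + 2 * α - γ) * t))) atTop (𝓝 0) := by
    have h1 : Tendsto (fun s : ℝ => -((1 + 2 * α - γ) * s)) atTop atBot :=
      tendsto_neg_atTop_atBot.comp (tendsto_id.const_mul_atTop (by linarith))
    simpa using (Real.tendsto_exp_atBot.comp h1).const_mul C
  refine squeeze_zero' (Eventually.of_forall fun t => by positivity) ?_ hlim
  filter_upwards [eventually_ge_atTop T] with t ht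
  rw [hv t (hT.trans ht)]
  calc _ ≤ C * Real.exp (-((1 + 2 * α) * t)) * Real.exp (γ * t) := by
        gcongr
        exact hle t ht
    _ = _ := by
        rw [mul_assoc, ← Real.exp_add]
        ring_nf

/-- Outside the slow cone `v' = -v + o(v)`. This first gives decay of `v` at every rate below `1`;
the force is then negligible against `e^{-t}`, so `e^t v` converges, and reinserting the rate `1`
gives the error `e^{-(1+2α)t}`. The limit is not `0` because the logarithmic derivative of `|e^t v|`
is integrable. -/
theorem IsPhaseCurve.exists_fastProfile {B : H →L[ℝ] H} [CompleteSpace H] {m : ℝ}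
    (hm : 0 < m) (hc : ∀ x, m * ‖x‖ ^ 2 ≤ ⟪B x, x⟫_ℝ) {α : ℝ} (hα : 0 < α)
    {u v : ℝ → H} (h : IsPhaseCurve (force B α) u v) {T κ η : ℝ} (hT : 0 ≤ T) (hκ : 0 < κ)
    (hη : 0 < η) (hηκ : η * (1 + 1 / κ) ≤ α / (1 + 2 * α))
    (hg : ∀ t, T ≤ t → ‖force B α (u t)‖ ≤ η * ‖u t‖)
    (hne : ∀ t, 0 ≤ t → v t = 0 → u t ≠ 0)
    (hcone : ∀ t, T ≤ t → κ * ‖u t + v t‖ ≤ ‖v t‖) :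
    ∃ v₀ : H, v₀ ≠ 0 ∧ HasFastProfile α v₀ u := by
  set ε : ℝ := α / (1 + 2 * α) with hε
  set L : ℝ := 1 + 1 / κ with hL
  have hL0 : 0 < L := by positivity
  have hw : ∀ t, T ≤ t → ‖u t + v t‖ ≤ 1 / κ * ‖v t‖ := fun t ht => by
    rw [one_div, ← div_eq_inv_mul, le_div_iff₀' hκ]
    exact hcone t ht
  have huL : ∀ t, T ≤ t → ‖u t‖ ≤ L * ‖v t‖ := fun t ht => by
    have := norm_le_add_norm_add (u t) (v t)
    have := hw t ht
    rw [hL]; linarith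
  have hfε : ∀ t, T ≤ t → ‖force B α (u t)‖ ≤ ε * ‖v t‖ := fun t ht => by
    calc _ ≤ η * ‖u t‖ := hg t ht
      _ ≤ η * (L * ‖v t‖) := by gcongr; exact huL t ht
      _ = η * L * ‖v t‖ := by ring
      _ ≤ _ := by gcongr
  set G : ℝ := ‖B‖ ^ α * ‖B‖ * L ^ (2 * α) * L with hG
  have hBα : 0 ≤ ‖B‖ ^ α := Real.rpow_nonneg (norm_nonneg _) _
  have hG0 : 0 ≤ G := by positivity
  have hfG : ∀ t, T ≤ t → ‖force B α (u t)‖ ≤ G * (‖v t‖ ^ (2 * α) * ‖v t‖) := fun t ht => by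
    calc _ ≤ ‖B‖ ^ α * ‖B‖ * ‖u t‖ ^ (2 * α) * ‖u t‖ := norm_force_le hm hc hα _
      _ ≤ ‖B‖ ^ α * ‖B‖ * (L * ‖v t‖) ^ (2 * α) * (L * ‖v t‖) := by
          have := huL t ht
          gcongr
      _ = _ := by rw [Real.mul_rpow hL0.le (norm_nonneg _), hG]; ring
  have hIci : Ici T ⊆ Ici 0 := Ici_subset_Ici.2 hT
  have hexp : ∀ (b t : ℝ), HasDerivWithinAt (fun r : ℝ => Real.exp (b * r))
      (b * Real.exp (b * t)) (Ici T) t := fun b t => by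
    have h1 : HasDerivAt (fun r : ℝ => b * r) (b * 1) t := (hasDerivAt_id t).const_mul b
    exact (h1.exp.congr_deriv (by ring)).hasDerivWithinAt
  -- decay at the preliminary rate `1 - ε`
  set b : ℝ := 1 - ε with hb
  obtain ⟨A, hA⟩ : ∃ A : ℝ, ∀ t, T ≤ t → ‖v t‖ ≤ A * Real.exp (-(b * t)) := by
    set D : ℝ := Real.exp (2 * b * T) * ‖v T‖ ^ 2 with hD
    have hD0 : 0 ≤ D := by positivity
    refine ⟨√D, fun t ht => ?_⟩
    have hmono := le_of_hasDerivWithinAt_nonpos (T := T)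
      (y := fun r => Real.exp (2 * b * r) * ‖v r‖ ^ 2)
      (fun r hr => (hexp (2 * b) r).mul ((h.deriv_vel r (hT.trans hr)).mono hIci).norm_sq)
      (fun r hr => by
        have i1 := (abs_le.1 (abs_real_inner_le_norm (v r) (force B α (u r)))).1
        have i2 : ‖v r‖ * ‖force B α (u r)‖ ≤ ‖v r‖ * (ε * ‖v r‖) := by
          gcongr; exact hfε r hr
        rw [inner_sub_right, inner_neg_right, real_inner_self_eq_norm_sq]
        have i3 : 2 * b * ‖v r‖ ^ 2 + 2 * (-‖v r‖ ^ 2 - ⟪v r, force B α (u r)⟫_ℝ) ≤ 0 := by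
          rw [hb]; nlinarith
        have i4 := mul_nonpos_of_nonneg_of_nonpos (Real.exp_pos (2 * b * r)).le i3
        linarith) ht
    have h1 : ‖v t‖ ^ 2 ≤ (√D * Real.exp (-(b * t))) ^ 2 := by
      have e1 : Real.exp (-(b * t)) ^ 2 * Real.exp (2 * b * t) = 1 := by
        rw [← Real.exp_nat_mul, ← Real.exp_add, ← Real.exp_zero]
        congr 1; push_cast; ring
      rw [mul_pow, Real.sq_sqrt hD0]
      calc ‖v t‖ ^ 2 = Real.exp (-(b * t)) ^ 2 * (Real.exp (2 * b * t) * ‖v t‖ ^ 2) := by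
            rw [← mul_assoc, e1, one_mul]
        _ ≤ Real.exp (-(b * t)) ^ 2 * D := by gcongr
        _ = _ := by ring
    exact le_of_sq_le_sq h1 (by positivity)
  -- `q = e^t v` converges
  set q : ℝ → H := fun t => Real.exp (1 * t) • v t with hq
  have hqd : ∀ t, T ≤ t →
      HasDerivWithinAt q (-(Real.exp t • force B α (u t))) (Ici T) t := fun t ht => by
    refine ((hexp 1 t).smul ((h.deriv_vel t (hT.trans ht)).mono hIci)).congr_deriv ?_
    simp only [one_mul, smul_sub, smul_neg]
    abel
  have hforce_decay : ∀ {A b : ℝ}, (∀ t, T ≤ t → ‖v t‖ ≤ A * Real.exp (-(b * t))) → ∀ t, T ≤ t →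
      ‖force B α (u t)‖ ≤ G * (A ^ (2 * α) * A) * Real.exp (-((1 + 2 * α) * b * t)) := by
    intro A b hAb t ht
    calc _ ≤ G * (‖v t‖ ^ (2 * α) * ‖v t‖) := hfG t ht
      _ ≤ G * (A ^ (2 * α) * A * Real.exp (-((1 + 2 * α) * b * t))) := by
          exact mul_le_mul_of_nonneg_left
            (rpow_mul_self_le_exp hα (norm_nonneg _) (hAb t ht)) hG0
      _ = _ := by ring
  have hq_decay : ∀ {A b c : ℝ}, (1 + 2 * α) * b = 1 + c →
      (∀ t, T ≤ t → ‖v t‖ ≤ A * Real.exp (-(b * t))) → ∀ t, T ≤ t →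
      ‖-(Real.exp t • force B α (u t))‖ ≤ G * (A ^ (2 * α) * A) * Real.exp (-(c * t)) := by
    intro A b c hbc hAb t ht
    rw [norm_neg, norm_smul, Real.norm_of_nonneg (Real.exp_pos _).le]
    calc _ ≤ Real.exp t * (G * (A ^ (2 * α) * A) * Real.exp (-((1 + 2 * α) * b * t))) := by
          gcongr; exact hforce_decay hAb t ht
      _ = G * (A ^ (2 * α) * A) * (Real.exp t * Real.exp (-((1 + 2 * α) * b * t))) := by ring
      _ = _ := by
          rw [← Real.exp_add, hbc]
          ring_nf
  obtain ⟨L₀, -, hL₀⟩ := exists_limit_of_norm_deriv_le_exp hα hqd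
    (hq_decay (b := b) (c := α) (by rw [hb, hε]; field_simp; ring) hA)
  obtain ⟨M, hM⟩ : ∃ M : ℝ, ∀ t, T ≤ t → ‖v t‖ ≤ M * Real.exp (-(1 * t)) := by
    refine ⟨‖L₀‖ + G * (A ^ (2 * α) * A) / α, fun t ht => ?_⟩
    have hA0 : 0 ≤ A :=
      nonneg_of_mul_nonneg_left ((norm_nonneg _).trans (hA T le_rfl)) (Real.exp_pos _)
    have h1 : ‖q t‖ ≤ ‖L₀‖ + G * (A ^ (2 * α) * A) / α := by
      have h2 := norm_le_norm_add_norm_sub' (q t) L₀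
      have h3 := hL₀ t ht
      have h4 : Real.exp (-(α * t)) ≤ 1 := Real.exp_le_one_iff.2 (by
        have := mul_nonneg hα.le (hT.trans ht); linarith)
      have h5 : G * (A ^ (2 * α) * A) / α * Real.exp (-(α * t)) ≤ G * (A ^ (2 * α) * A) / α * 1 :=
        by gcongr
      linarith
    have e : v t = Real.exp (-(1 * t)) • q t := by
      rw [hq, smul_smul, ← Real.exp_add]; simp
    rw [e, norm_smul, Real.norm_of_nonneg (Real.exp_pos _).le, mul_comm]
    gcongr
  have h2α : 0 < 2 * α := by positivity
  obtain ⟨L₁, hL₁lim, hL₁⟩ := exists_limit_of_norm_deriv_le_exp h2α hqd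
    (hq_decay (b := 1) (c := 2 * α) (by ring) hM)
  -- `u + v` tends to `0` at the rate `1 + 2 α`
  obtain ⟨W, hWlim, hW⟩ := exists_limit_of_norm_deriv_le_exp (c := 1 + 2 * α) (by positivity)
    (y := fun t => u t + v t) (y' := fun t => -force B α (u t))
    (fun t ht => (h.deriv_add (hT.trans ht)).mono hIci)
    (fun t ht => by simpa using hforce_decay hM t ht)
  have hW0 : W = 0 := by
    refine tendsto_nhds_unique hWlim ?_
    have hlim : Tendsto (fun t : ℝ => 1 / κ * (M * Real.exp (-(1 * t)))) atTop (𝓝 0) := by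
      have := (Real.tendsto_exp_neg_atTop_nhds_zero.const_mul M).const_mul (1 / κ)
      simpa using this
    refine squeeze_zero_norm' ?_ hlim
    filter_upwards [eventually_ge_atTop T] with t ht
    refine (hw t ht).trans ?_
    gcongr
    exact hM t ht
  have hM0 : 0 ≤ M :=
    nonneg_of_mul_nonneg_left ((norm_nonneg _).trans (hM T le_rfl)) (Real.exp_pos _)
  -- `Z = |q|² exp(-(N / α) e^{-2αt})` is nondecreasing, so the limit of `q` is not `0`
  set N : ℝ := G * M ^ (2 * α) with hN
  have hN0 : 0 ≤ N := by positivity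
  have hqf : ∀ t, T ≤ t →
      ‖Real.exp t • force B α (u t)‖ ≤ N * Real.exp (-(2 * α) * t) * ‖q t‖ := by
    intro t ht
    have h1 : ‖v t‖ ^ (2 * α) ≤ M ^ (2 * α) * Real.exp (-(2 * α) * t) := by
      have h2 := Real.rpow_le_rpow (norm_nonneg _) (hM t ht) h2α.le
      rw [Real.mul_rpow hM0 (Real.exp_pos _).le, ← Real.exp_mul] at h2
      convert h2 using 3
      ring
    have h3 : ‖q t‖ = Real.exp t * ‖v t‖ := by
      rw [hq, norm_smul, Real.norm_of_nonneg (Real.exp_pos _).le, one_mul]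
    rw [norm_smul, Real.norm_of_nonneg (Real.exp_pos _).le, h3]
    calc _ ≤ Real.exp t * (G * ((M ^ (2 * α) * Real.exp (-(2 * α) * t)) * ‖v t‖)) := by
          gcongr
          refine (hfG t ht).trans ?_
          gcongr
      _ = _ := by rw [hN]; ring
  have hZ : ∀ t, T ≤ t → Real.exp (-(N / α * Real.exp (-(2 * α) * T))) * ‖q T‖ ^ 2 ≤ ‖q t‖ ^ 2 := by
    intro t ht
    have hmono := le_of_hasDerivWithinAt_nonpos (T := T)
      (y := fun r => -(Real.exp (-(N / α * Real.exp (-(2 * α) * r))) * ‖q r‖ ^ 2))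
      (fun r hr => ((((hexp (-(2 * α)) r).const_mul (N / α)).neg.exp).mul (hqd r hr).norm_sq).neg)
      (fun r hr => by
        have i1 := (abs_le.1 (abs_real_inner_le_norm (q r) (Real.exp r • force B α (u r)))).2
        have i2 : ‖q r‖ * ‖Real.exp r • force B α (u r)‖
            ≤ ‖q r‖ * (N * Real.exp (-(2 * α) * r) * ‖q r‖) := by
          gcongr; exact hqf r hr
        rw [inner_neg_right]
        have e : N / α * (-(2 * α) * Real.exp (-(2 * α) * r))
            = -(2 * N * Real.exp (-(2 * α) * r)) := by field_simp
        rw [e]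
        have i3 : 0 ≤ 2 * N * Real.exp (-(2 * α) * r) * ‖q r‖ ^ 2
            - 2 * ⟪q r, Real.exp r • force B α (u r)⟫_ℝ := by nlinarith
        have i4 := mul_nonneg (Real.exp_pos (-(N / α * Real.exp (-(2 * α) * r)))).le i3
        simp only [Pi.neg_apply]
        linarith) ht
    have h1 : Real.exp (-(N / α * Real.exp (-(2 * α) * t))) ≤ 1 :=
      Real.exp_le_one_iff.2 (neg_nonpos.2 (by positivity))
    have h2 : Real.exp (-(N / α * Real.exp (-(2 * α) * t))) * ‖q t‖ ^ 2 ≤ 1 * ‖q t‖ ^ 2 := by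
      gcongr
    linarith
  have hvT : v T ≠ 0 := by
    intro h0
    have h1 : ‖u T‖ ≤ 0 := by simpa [h0] using huL T le_rfl
    exact hne T hT h0 (norm_le_zero_iff.1 h1)
  have hL₁0 : L₁ ≠ 0 := by
    intro h0
    have h1 : 0 < Real.exp (-(N / α * Real.exp (-(2 * α) * T))) * ‖q T‖ ^ 2 := by
      have : q T ≠ 0 := smul_ne_zero (Real.exp_pos _).ne' hvT
      positivity
    have h2 := ge_of_tendsto (hL₁lim.norm.pow 2)
      ((eventually_ge_atTop T).mono fun t ht => hZ t ht)
    rw [h0, norm_zero, zero_pow two_ne_zero] at h2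
    linarith
  refine ⟨-L₁, neg_ne_zero.2 hL₁0, ?_⟩
  set F : ℝ := G * (M ^ (2 * α) * M) with hF
  refine hasFastProfile_of_le (v := v) (T := T) (C := 2 * (F / (2 * α)) + F / (1 + 2 * α)) hT
    (fun t ht => h.timeDeriv_eq ht) (fun t ht => ?_)
  have h1 : ‖v t + Real.exp (-t) • -L₁‖ ≤ F / (2 * α) * Real.exp (-((1 + 2 * α) * t)) := by
    have e : v t + Real.exp (-t) • -L₁ = Real.exp (-t) • (q t - L₁) := by
      rw [hq, smul_sub, smul_smul, ← Real.exp_add, smul_neg, ← sub_eq_add_neg]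
      simp
    rw [e, norm_smul, Real.norm_of_nonneg (Real.exp_pos _).le]
    calc _ ≤ Real.exp (-t) * (F / (2 * α) * Real.exp (-(2 * α * t))) := by
          gcongr; exact hL₁ t ht
      _ = F / (2 * α) * (Real.exp (-t) * Real.exp (-(2 * α * t))) := by ring
      _ = _ := by
          rw [← Real.exp_add]
          ring_nf
  have h2 : ‖u t - Real.exp (-t) • -L₁‖ ≤ ‖u t + v t‖ + ‖v t + Real.exp (-t) • -L₁‖ := by
    have e : u t - Real.exp (-t) • -L₁ = (u t + v t) - (v t + Real.exp (-t) • -L₁) := by abel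
    rw [e]
    exact norm_sub_le _ _
  have h3 := hW t ht
  rw [hW0, sub_zero] at h3
  linarith

/-! ### Exponentially weighted tail integrals -/

/-- The tail integral `∫_t^∞ e^{-bs} h(s) ds`. -/
noncomputable def expTail {E : Type*} [NormedAddCommGroup E] [NormedSpace ℝ E] (b : ℝ)
    (h : ℝ → E) (t : ℝ) : E :=
  ∫ s in Ioi t, Real.exp (-b * s) • h s

section ExpTail

variable {E : Type*} [NormedAddCommGroup E] [NormedSpace ℝ E] {b D : ℝ} {h k : ℝ → E}

theorem integrableOn_expTail (hb : 0 < b) (hh : Continuous h) (hD : ∀ s, ‖h s‖ ≤ D) (t : ℝ) :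
    MeasureTheory.IntegrableOn (fun s => Real.exp (-b * s) • h s) (Ioi t) := by
  have hc : Continuous fun s => Real.exp (-b * s) • h s :=
    (Real.continuous_exp.comp (continuous_const.mul continuous_id)).smul hh
  refine ((integrableOn_exp_mul_Ioi (neg_lt_zero.2 hb) t).mul_const D).mono'
    hc.aestronglyMeasurable (Eventually.of_forall fun s => ?_)
  rw [norm_smul, Real.norm_of_nonneg (Real.exp_pos _).le]
  gcongr
  exact hD s

theorem norm_expTail_le (hb : 0 < b) (hD : ∀ s, ‖h s‖ ≤ D) (t : ℝ) :
    ‖expTail b h t‖ ≤ D / b * Real.exp (-b * t) := by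
  have h1 := MeasureTheory.norm_integral_le_of_norm_le
    (μ := MeasureTheory.volume.restrict (Ioi t)) (f := fun s => Real.exp (-b * s) • h s)
    ((integrableOn_exp_mul_Ioi (neg_lt_zero.2 hb) t).mul_const D)
    (Eventually.of_forall fun s => by
      rw [norm_smul, Real.norm_of_nonneg (Real.exp_pos _).le]
      gcongr
      exact hD s)
  refine h1.trans (le_of_eq ?_)
  rw [MeasureTheory.integral_mul_const, integral_exp_mul_Ioi (neg_lt_zero.2 hb)]
  field_simp

theorem expTail_sub {D' : ℝ} (hb : 0 < b) (hh : Continuous h) (hD : ∀ s, ‖h s‖ ≤ D)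
    (hk : Continuous k) (hD' : ∀ s, ‖k s‖ ≤ D') (t : ℝ) :
    expTail b (fun s => h s - k s) t = expTail b h t - expTail b k t := by
  simp only [expTail, smul_sub]
  exact MeasureTheory.integral_sub (integrableOn_expTail hb hh hD t)
    (integrableOn_expTail hb hk hD' t)

theorem hasDerivAt_expTail [CompleteSpace E] (hb : 0 < b) (hh : Continuous h)
    (hD : ∀ s, ‖h s‖ ≤ D) (t : ℝ) :
    HasDerivAt (expTail b h) (-(Real.exp (-b * t) • h t)) t := by
  have hc : Continuous fun s => Real.exp (-b * s) • h s :=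
    (Real.continuous_exp.comp (continuous_const.mul continuous_id)).smul hh
  have e : expTail b h = fun r => expTail b h 0 - ∫ s in (0 : ℝ)..r, Real.exp (-b * s) • h s := by
    funext r
    rw [← intervalIntegral.integral_Ioi_sub_Ioi' (integrableOn_expTail hb hh hD 0)
      (integrableOn_expTail hb hh hD r)]
    simp [expTail]
  rw [e]
  exact (intervalIntegral.integral_hasDerivAt_right (hc.intervalIntegrable _ _)
    (hc.stronglyMeasurableAtFilter _ _) hc.continuousAt).const_sub _

/-- The integral equation of the fast regime, in the unknown `z = e^t u`, solved by contraction in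
the space of bounded continuous functions. -/
theorem exists_fixedPoint_expTail [CompleteSpace E] {g : E → E} {K a : ℝ} (ha : 0 < a)
    (hK : 0 ≤ K) (hKa : 4 * K ≤ a) (hg : ∀ x y, ‖g x - g y‖ ≤ K * ‖x - y‖) (hg0 : g 0 = 0)
    (v₀ : E) :
    ∃ z : ℝ → E, Continuous z ∧ (∀ t, ‖z t‖ ≤ 2 * ‖v₀‖) ∧ ∀ t, 0 ≤ t →
      z t = v₀ - expTail a (fun s => g (z s)) t
        + Real.exp t • expTail (1 + a) (fun s => g (z s)) t := by
  let X := BoundedContinuousFunction ℝ E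
  have hgc : Continuous g :=
    (LipschitzWith.of_dist_le_mul (K := ⟨K, hK⟩) (f := g)
      (fun x y => by rw [dist_eq_norm, dist_eq_norm]; exact hg x y)).continuous
  have ha1 : 0 < 1 + a := by positivity
  let P : (ℝ → E) → ℝ → E := fun h t =>
    expTail a h (max t 0) - Real.exp (max t 0) • expTail (1 + a) h (max t 0)
  have hPle : ∀ (h : ℝ → E) (D : ℝ), (∀ s, ‖h s‖ ≤ D) → ∀ t, ‖P h t‖ ≤ 2 * (D / a) := by
    intro h D hD t
    have hD0 : 0 ≤ D := (norm_nonneg _).trans (hD 0)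
    have ht : 0 ≤ max t 0 := le_max_right _ _
    have he : Real.exp (-a * max t 0) ≤ 1 := Real.exp_le_one_iff.2 (by nlinarith)
    have h1 : ‖expTail a h (max t 0)‖ ≤ D / a * 1 :=
      (norm_expTail_le ha hD _).trans (by gcongr)
    have h2 : ‖Real.exp (max t 0) • expTail (1 + a) h (max t 0)‖ ≤ D / a * 1 := by
      rw [norm_smul, Real.norm_of_nonneg (Real.exp_pos _).le]
      calc _ ≤ Real.exp (max t 0) * (D / (1 + a) * Real.exp (-(1 + a) * max t 0)) := by
            gcongr; exact norm_expTail_le ha1 hD _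
        _ = D / (1 + a) * (Real.exp (max t 0) * Real.exp (-(1 + a) * max t 0)) := by ring
        _ = D / (1 + a) * Real.exp (-a * max t 0) := by rw [← Real.exp_add]; ring_nf
        _ ≤ D / a * 1 := by gcongr; linarith
    refine (norm_sub_le _ _).trans ?_
    linarith
  have hgz : ∀ z : X, Continuous fun s => g (z s) := fun z => hgc.comp z.continuous
  have hgb : ∀ (z : X) s, ‖g (z s)‖ ≤ K * ‖z‖ := fun z s => by
    have := hg (z s) 0
    rw [hg0, sub_zero, sub_zero] at this
    exact this.trans (by gcongr; exact z.norm_coe_le_norm s)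
  have hPc : ∀ z : X, Continuous (P fun s => g (z s)) := fun z => by
    have h1 : Continuous (expTail a fun s => g (z s)) :=
      continuous_iff_continuousAt.2 fun t =>
        (hasDerivAt_expTail ha (hgz z) (hgb z) t).continuousAt
    have h2 : Continuous (expTail (1 + a) fun s => g (z s)) :=
      continuous_iff_continuousAt.2 fun t =>
        (hasDerivAt_expTail ha1 (hgz z) (hgb z) t).continuousAt
    have h3 : Continuous fun t : ℝ => max t 0 := by fun_prop
    exact (h1.comp h3).sub ((Real.continuous_exp.comp h3).smul (h2.comp h3))
  have hPsub : ∀ (y z : X) t, P (fun s => g (y s) - g (z s)) t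
      = P (fun s => g (y s)) t - P (fun s => g (z s)) t := fun y z t => by
    simp only [P]
    rw [expTail_sub ha (hgz y) (hgb y) (hgz z) (hgb z),
      expTail_sub ha1 (hgz y) (hgb y) (hgz z) (hgb z), smul_sub]
    abel
  let Φ : X → X := fun z => BoundedContinuousFunction.ofNormedAddCommGroup
    (fun t => v₀ - P (fun s => g (z s)) t) (continuous_const.sub (hPc z))
    (‖v₀‖ + 2 * (K * ‖z‖ / a))
    (fun t => (norm_sub_le _ _).trans (by gcongr; exact hPle _ _ (hgb z) t))
  have hKa' : ∀ d : ℝ, 0 ≤ d → 2 * (K * d / a) ≤ 1 / 2 * d := fun d hd => by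
    have h1 : K * d / a ≤ 1 / 4 * d := by
      rw [div_le_iff₀ ha]
      nlinarith
    linarith
  have hlip : ContractingWith ⟨1 / 2, by norm_num⟩ Φ := by
    refine ⟨?_, LipschitzWith.of_dist_le_mul fun y z => ?_⟩
    · change (1 / 2 : ℝ) < 1
      norm_num
    · rw [dist_eq_norm, dist_eq_norm]
      change _ ≤ 1 / 2 * ‖y - z‖
      refine (BoundedContinuousFunction.norm_le (by positivity)).2 fun t => ?_
      have e : (Φ y - Φ z) t = -P (fun s => g (y s) - g (z s)) t := by
        rw [hPsub]
        change (v₀ - P (fun s => g (y s)) t) - (v₀ - P (fun s => g (z s)) t) = _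
        abel
      rw [e, norm_neg]
      refine (hPle _ (K * ‖y - z‖) (fun s => (hg _ _).trans ?_) t).trans
        (hKa' _ (norm_nonneg _))
      gcongr
      exact (y - z).norm_coe_le_norm s
  set z : X := hlip.fixedPoint with hz
  have hfix : Φ z = z := hlip.fixedPoint_isFixedPt
  have hzt : ∀ t, z t = v₀ - P (fun s => g (z s)) t := fun t => by
    conv_lhs => rw [← hfix]
    rfl
  have hzn : ‖z‖ ≤ 2 * ‖v₀‖ := by
    have h1 : ‖z‖ ≤ ‖v₀‖ + 1 / 2 * ‖z‖ := by
      refine (BoundedContinuousFunction.norm_le (by positivity)).2 fun t => ?_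
      rw [hzt t]
      refine (norm_sub_le _ _).trans ?_
      gcongr
      exact (hPle _ _ (hgb z) t).trans (hKa' _ (norm_nonneg _))
    linarith
  refine ⟨z, z.continuous, fun t => (z.norm_coe_le_norm t).trans hzn, fun t ht => ?_⟩
  rw [hzt t]
  simp only [P, max_eq_left ht]
  abel

end ExpTail

/-! ### Existence of fast solutions -/

/-- With `z = e^t u`, homogeneity of the force turns the equation with the profile `v₀ e^{-t}`
prescribed at infinity into the integral equation of `exists_fixedPoint_expTail`. -/
theorem exists_fast_solution [CompleteSpace H] {B : H →L[ℝ] H} {m : ℝ}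
    (hs : B.IsSymmetric) (hm : 0 < m) (hc : ∀ x, m * ‖x‖ ^ 2 ≤ ⟪B x, x⟫_ℝ) {α : ℝ}
    (hα : 0 < α) :
    ∃ ε : ℝ, 0 < ε ∧ ∀ v₀ : H, ‖v₀‖ < ε →
      ∃ u : ℝ → H, IsGlobalSolution B α u ∧ HasFastProfile α v₀ u := by
  set Λ : ℝ := ‖B‖ + 2 * α * ‖sqrtOp B‖ ^ 2 with hΛ
  have hΛ0 : 0 ≤ Λ := by positivity
  -- `R` makes the Lipschitz constant of the truncated force at most `α / 2`
  set R : ℝ := (α / (2 * (Λ + 1))) ^ (1 / (2 * α)) with hR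
  have hR0 : 0 < R := by positivity
  have hRpow : R ^ (2 * α) = α / (2 * (Λ + 1)) := by
    rw [hR, ← Real.rpow_mul (by positivity), one_div_mul_cancel (by positivity), Real.rpow_one]
  have hKle : R ^ (2 * α) * Λ ≤ α / 2 := by
    rw [hRpow, div_mul_eq_mul_div, div_le_div_iff₀ (by positivity) (by positivity)]
    nlinarith
  refine ⟨R / (2 * (‖sqrtOp B‖ + 1)), by positivity, fun v₀ hv₀ => ?_⟩
  obtain ⟨z, hzc, hzb, hz⟩ := exists_fixedPoint_expTail (g := truncForce B α R)
    (K := R ^ (2 * α) * Λ) (a := 2 * α) (by positivity) (by positivity) (by linarith)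
    (norm_truncForce_sub_le hs hm hc hα hR0.le) (truncForce_zero B α R) v₀
  have hzR : ∀ t, ‖sqrtOp B (z t)‖ ≤ R := fun t => by
    rw [lt_div_iff₀ (by positivity)] at hv₀
    calc _ ≤ ‖sqrtOp B‖ * ‖z t‖ := (sqrtOp B).le_opNorm _
      _ ≤ ‖sqrtOp B‖ * (2 * ‖v₀‖) := by gcongr; exact hzb t
      _ ≤ ‖v₀‖ * (2 * (‖sqrtOp B‖ + 1)) := by nlinarith [norm_nonneg v₀]
      _ ≤ R := hv₀.le
  simp only [truncForce_eq_force hs hm hc (hzR _)] at hz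
  set f : ℝ → H := fun s => force B α (z s) with hf
  have hfc : Continuous f := (continuous_force hα).comp hzc
  obtain ⟨D, hD⟩ : ∃ D : ℝ, ∀ s, ‖f s‖ ≤ D := by
    refine ⟨‖B‖ ^ α * ‖B‖ * (2 * ‖v₀‖) ^ (2 * α) * (2 * ‖v₀‖), fun s => ?_⟩
    refine (norm_force_le hm hc hα _).trans ?_
    have := hzb s
    have hBα : 0 ≤ ‖B‖ ^ α := Real.rpow_nonneg (norm_nonneg _) _
    gcongr
  have h2α : 0 < 2 * α := by positivity
  have h2α1 : 0 < 1 + 2 * α := by positivity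
  set I : ℝ → H := expTail (2 * α) f with hI
  set J : ℝ → H := expTail (1 + 2 * α) f with hJ
  have hId : ∀ t, HasDerivAt I (-(Real.exp (-(2 * α) * t) • f t)) t :=
    hasDerivAt_expTail h2α hfc hD
  have hJd : ∀ t, HasDerivAt J (-(Real.exp (-(1 + 2 * α) * t) • f t)) t :=
    hasDerivAt_expTail h2α1 hfc hD
  have hE : ∀ t, HasDerivAt (fun r : ℝ => Real.exp (-r)) (-Real.exp (-t)) t := fun t =>
    ((hasDerivAt_neg t).exp).congr_deriv (by ring)
  have hEE : ∀ t, Real.exp (-t) * Real.exp (-(2 * α) * t) = Real.exp (-(1 + 2 * α) * t) :=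
    fun t => by rw [← Real.exp_add]; ring_nf
  let u : ℝ → H := fun t => Real.exp (-t) • (v₀ - I t) + J t
  let v : ℝ → H := fun t => -(Real.exp (-t) • (v₀ - I t))
  have huz : ∀ t, 0 ≤ t → u t = Real.exp (-t) • z t := fun t ht => by
    rw [hz t ht, smul_add, smul_smul, ← Real.exp_add]
    simp [u, hI, hJ, hf]
  have hfu : ∀ t, 0 ≤ t → force B α (u t) = Real.exp (-(1 + 2 * α) * t) • f t := fun t ht => by
    rw [huz t ht, force_smul hm hc (Real.exp_pos _).le, ← Real.exp_mul, ← Real.exp_add]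
    congr 2
    ring
  have hprod : ∀ t, HasDerivAt (fun r => Real.exp (-r) • (v₀ - I r))
      (-(Real.exp (-t) • (v₀ - I t)) + Real.exp (-(1 + 2 * α) * t) • f t) t := fun t => by
    refine ((hE t).smul ((hId t).const_sub v₀)).congr_deriv ?_
    rw [neg_neg, smul_smul, hEE, neg_smul, add_comm]
  have hphase : IsPhaseCurve (force B α) u v := by
    refine ⟨fun t ht => ?_, fun t ht => ?_⟩
    · refine ((hprod t).add (hJd t)).hasDerivWithinAt.congr_deriv ?_
      simp [v]
    · refine (hprod t).neg.hasDerivWithinAt.congr_deriv ?_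
      rw [hfu t ht]
      simp only [v]
      abel
  refine ⟨u, hphase.isGlobalSolution hs hm hc hα, ?_⟩
  refine hasFastProfile_of_le (v := v) (T := 0) (C := 2 * (D / (2 * α)) + D / (1 + 2 * α)) le_rfl
    (fun t ht => hphase.timeDeriv_eq ht) (fun t ht => ?_)
  have e1 : v t + Real.exp (-t) • v₀ = Real.exp (-t) • I t := by
    simp only [v, smul_sub]
    abel
  have e2 : u t - Real.exp (-t) • v₀ = J t - Real.exp (-t) • I t := by
    simp only [u, smul_sub]
    abel
  have h1 : ‖Real.exp (-t) • I t‖ ≤ D / (2 * α) * Real.exp (-((1 + 2 * α) * t)) := by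
    rw [norm_smul, Real.norm_of_nonneg (Real.exp_pos _).le, ← neg_mul, ← hEE]
    calc _ ≤ Real.exp (-t) * (D / (2 * α) * Real.exp (-(2 * α) * t)) := by
          gcongr; exact norm_expTail_le h2α hD t
      _ = _ := by ring
  have h2 : ‖J t‖ ≤ D / (1 + 2 * α) * Real.exp (-((1 + 2 * α) * t)) := by
    rw [← neg_mul]
    exact norm_expTail_le h2α1 hD t
  rw [e1, e2]
  have h3 := norm_sub_le (J t) (Real.exp (-t) • I t)
  linarith

/-! ### The slow-fast alternative -/

theorem IsPhaseCurve.vel_ne_zero_or_pos_ne_zero [CompleteSpace H] {B : H →L[ℝ] H} {m : ℝ}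
    (hs : B.IsSymmetric) (hm : 0 < m) (hc : ∀ x, m * ‖x‖ ^ 2 ≤ ⟪B x, x⟫_ℝ) {α : ℝ} (hα : 0 < α)
    {u v : ℝ → H} (h : IsPhaseCurve (force B α) u v) (hne : ∃ t, 0 ≤ t ∧ u t ≠ 0) (t : ℝ)
    (ht : 0 ≤ t) (hv : v t = 0) : u t ≠ 0 := by
  obtain ⟨s, hs0, hus⟩ := hne
  intro hu
  have hzero : IsPhaseCurve (force B α) (fun _ => (0 : H)) (fun _ => 0) :=
    ⟨fun r _ => hasDerivWithinAt_const r _ _,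
      fun r _ => (hasDerivWithinAt_const r _ _).congr_deriv (by simp)⟩
  exact hus (h.eq_of_eq_at hs hm hc hα hzero ht hu hv hs0)

theorem IsPhaseCurve.exists_pos_ne_zero {g : H → H} {u v : ℝ → H} (h : IsPhaseCurve g u v)
    (h0 : u 0 + v 0 ≠ 0) : ∃ t, 0 ≤ t ∧ u t ≠ 0 := by
  by_contra! hall
  have h1 : timeDeriv u 0 = 0 := by
    have : HasDerivWithinAt u 0 (Ici 0) 0 :=
      (hasDerivWithinAt_const 0 (Ici 0) (0 : H)).congr (fun t ht => hall t ht) (hall 0 le_rfl)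
    exact this.derivWithin (uniqueDiffOn_Ici 0 0 self_mem_Ici)
  rw [h.timeDeriv_eq le_rfl] at h1
  exact h0 (by rw [hall 0 le_rfl, h1, add_zero])

/-- The factor `η` such that `|force| ≤ η |u|` makes the force negligible for both the invariance of
the slow cone and the analysis outside it. -/
noncomputable def forceThreshold (B : H →L[ℝ] H) (m α : ℝ) : ℝ :=
  α / (1 + 2 * α) / (1 + 1 / coneAperture B m)

theorem forceThreshold_pos (B : H →L[ℝ] H) {m α : ℝ} (hm : 0 < m) (hα : 0 < α) :
    0 < forceThreshold B m α := by
  have := coneAperture_pos B hm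
  unfold forceThreshold
  positivity

theorem forceThreshold_mul (B : H →L[ℝ] H) {m α : ℝ} (hm : 0 < m) :
    forceThreshold B m α * (1 + 1 / coneAperture B m) = α / (1 + 2 * α) := by
  have := coneAperture_pos B hm
  exact div_mul_cancel₀ _ (by positivity)

theorem IsPhaseCurve.isSlowFrom_of_cone {B : H →L[ℝ] H} {m : ℝ}
    (hm : 0 < m) (hc : ∀ x, m * ‖x‖ ^ 2 ≤ ⟪B x, x⟫_ℝ) {α : ℝ} (hα : 0 < α)
    {u v : ℝ → H} (h : IsPhaseCurve (force B α) u v) {T : ℝ} (hT : 0 ≤ T)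
    (hg : ∀ t, T ≤ t → ‖force B α (u t)‖ ≤ forceThreshold B m α * ‖u t‖)
    (hne : ∀ t, 0 ≤ t → v t = 0 → u t ≠ 0)
    (hcone : ‖v T‖ ≤ coneAperture B m * ‖u T + v T‖) : IsSlowFrom α T u := by
  have hhalf : forceThreshold B m α * (1 + 1 / coneAperture B m) ≤ 1 / 2 := by
    rw [forceThreshold_mul B hm, div_le_div_iff₀ (by positivity) (by positivity)]
    linarith
  obtain ⟨C₁, C₂, hC₁, hC₂, hb⟩ := h.exists_bounds_of_cone hm hc hα hT hne fun t ht =>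
    h.cone_invariant hT (coneAperture_pos B hm) (coneAperture_le B hm)
      (forceThreshold_pos B hm hα) hhalf hg hne hcone ht
  exact isSlowFrom_of_bounds hα hT h.continuousOn_pos hC₁ hC₂ hb

theorem IsPhaseCurve.slow_or_fast [CompleteSpace H] {B : H →L[ℝ] H} {m : ℝ}
    (hs : B.IsSymmetric) (hm : 0 < m) (hc : ∀ x, m * ‖x‖ ^ 2 ≤ ⟪B x, x⟫_ℝ) {α : ℝ} (hα : 0 < α)
    {u v : ℝ → H} (h : IsPhaseCurve (force B α) u v) (hne : ∃ t, 0 ≤ t ∧ u t ≠ 0) :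
    (∃ T₀ : ℝ, 0 ≤ T₀ ∧ IsSlowFrom α T₀ u) ∨ ∃ v₀ : H, v₀ ≠ 0 ∧ HasFastProfile α v₀ u := by
  have hne' := h.vel_ne_zero_or_pos_ne_zero hs hm hc hα hne
  have hη := forceThreshold_pos B hm hα
  obtain ⟨δ, hδ, hδf⟩ := exists_norm_force_le_of_energy_le hm hc hα hη
  obtain ⟨T, hT⟩ := eventually_atTop.1
    ((h.tendsto_energy hs hm hc hα).eventually (gt_mem_nhds hδ))
  have hT0 : 0 ≤ max T 0 := le_max_right _ _
  have hg : ∀ t, max T 0 ≤ t → ‖force B α (u t)‖ ≤ forceThreshold B m α * ‖u t‖ := fun t ht =>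
    hδf (u t) (v t) (hT t ((le_max_left _ _).trans ht)).le
  by_cases hcone : ∃ T₁, max T 0 ≤ T₁ ∧ ‖v T₁‖ ≤ coneAperture B m * ‖u T₁ + v T₁‖
  · obtain ⟨T₁, hT₁, hc₁⟩ := hcone
    exact Or.inl ⟨T₁, hT0.trans hT₁, h.isSlowFrom_of_cone hm hc hα (hT0.trans hT₁)
      (fun t ht => hg t (hT₁.trans ht)) hne' hc₁⟩
  · push Not at hcone
    exact Or.inr (h.exists_fastProfile hm hc hα hT0 (coneAperture_pos B hm) hη
      (forceThreshold_mul B hm).le hg hne' fun t ht => (hcone t ht).le)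

theorem not_isSlowFrom_of_hasFastProfile {α T₀ : ℝ} (hα : 0 < α) {u : ℝ → H} {v₀ : H}
    (hslow : IsSlowFrom α T₀ u) (hfast : HasFastProfile α v₀ u) : False := by
  obtain ⟨C₁, -, hC₁, -, hlo, -⟩ := hslow
  set p := 1 / (2 * α)
  have h1 : Tendsto (fun t : ℝ => (1 + t) ^ p * Real.exp (-(1 / 2) * (1 + t))) atTop (𝓝 0) :=
    (tendsto_rpow_mul_exp_neg_mul_atTop_nhds_zero p (1 / 2) (by norm_num)).comp
      (tendsto_atTop_add_const_left _ 1 tendsto_id)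
  have h2 : Tendsto (fun t : ℝ => Real.exp (-(1 / 2 * t))) atTop (𝓝 0) :=
    Real.tendsto_exp_neg_atTop_nhds_zero.comp (tendsto_id.const_mul_atTop (by norm_num))
  have h3 := ((hfast (1 / 2) (by linarith)).add (h2.mul_const ‖v₀‖)).mul
    (h1.mul_const (Real.exp (1 / 2)))
  have h4 : C₁ ≤ (0 + 0 * ‖v₀‖) * (0 * Real.exp (1 / 2)) := by
    refine ge_of_tendsto h3 ?_
    filter_upwards [eventually_ge_atTop T₀, eventually_ge_atTop 0] with t ht ht0
    have hp : 0 < (1 + t) ^ p := by positivity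
    have h5 := (div_le_iff₀ hp).1 (hlo t ht)
    have h6 : ‖u t‖ ≤ ‖u t - Real.exp (-t) • v₀‖ + Real.exp (-t) * ‖v₀‖ := by
      have := norm_le_norm_sub_add (u t) (Real.exp (-t) • v₀)
      rwa [norm_smul, Real.norm_of_nonneg (Real.exp_pos _).le] at this
    have e1 : Real.exp (-(1 / 2) * (1 + t)) * Real.exp (1 / 2) * Real.exp (1 / 2 * t) = 1 := by
      rw [← Real.exp_add, ← Real.exp_add, Real.exp_eq_one_iff]
      ring
    have e2 : Real.exp (-(1 / 2 * t)) = Real.exp (-t) * Real.exp (1 / 2 * t) := by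
      rw [← Real.exp_add]
      ring_nf
    have h7 : ‖u t‖ ≤ ‖timeDeriv u t + Real.exp (-t) • v₀‖ + ‖u t - Real.exp (-t) • v₀‖
        + Real.exp (-t) * ‖v₀‖ := by
      have := norm_nonneg (timeDeriv u t + Real.exp (-t) • v₀)
      linarith
    calc C₁ ≤ ‖u t‖ * (1 + t) ^ p := h5
      _ ≤ (‖timeDeriv u t + Real.exp (-t) • v₀‖ + ‖u t - Real.exp (-t) • v₀‖
          + Real.exp (-t) * ‖v₀‖) * (1 + t) ^ p := by gcongr
      _ = (‖timeDeriv u t + Real.exp (-t) • v₀‖ + ‖u t - Real.exp (-t) • v₀‖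
          + Real.exp (-t) * ‖v₀‖) * (1 + t) ^ p *
          (Real.exp (-(1 / 2) * (1 + t)) * Real.exp (1 / 2) * Real.exp (1 / 2 * t)) := by
          rw [e1, mul_one]
      _ = _ := by rw [e2]; ring
  simp only [zero_mul, add_zero] at h4
  linarith

theorem exists_open_slow [CompleteSpace H] [Nontrivial H] {B : H →L[ℝ] H} {m : ℝ}
    (hs : B.IsSymmetric) (hm : 0 < m) (hc : ∀ x, m * ‖x‖ ^ 2 ≤ ⟪B x, x⟫_ℝ) {α : ℝ}
    (hα : 0 < α) :
    ∃ S : Set (H × H), IsOpen S ∧ S.Nonempty ∧ ∀ u v : ℝ → H, IsPhaseCurve (force B α) u v →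
      (u 0, v 0) ∈ S → IsSlowFrom α 0 u := by
  have hη := forceThreshold_pos B hm hα
  have hκ := coneAperture_pos B hm
  obtain ⟨δ, hδ, hδf⟩ := exists_norm_force_le_of_energy_le hm hc hα hη
  have hcont : Continuous fun p : H × H => energy B α p.1 p.2 := by
    refine (continuous_snd.norm.pow 2).add (Continuous.div_const ?_ _)
    exact ((B.continuous.comp continuous_fst).inner continuous_fst).rpow_const
      fun _ => Or.inr (by linarith)
  -- small energy, and inside the slow cone from the start
  refine ⟨{p | energy B α p.1 p.2 < δ} ∩ {p | ‖p.2‖ < coneAperture B m * ‖p.1 + p.2‖},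
    (isOpen_lt hcont continuous_const).inter (isOpen_lt (by fun_prop) (by fun_prop)), ?_, ?_⟩
  · obtain ⟨x, hx⟩ := exists_ne (0 : H)
    have hlim : Tendsto (fun c : ℝ => energy B α (c • x) 0) (𝓝[>] 0) (𝓝 0) := by
      have h1 : Continuous fun c : ℝ => energy B α (c • x) 0 :=
        hcont.comp ((continuous_id.smul continuous_const).prodMk continuous_const)
      have h2 : energy B α ((0 : ℝ) • x) 0 = 0 := by
        simp [energy, Real.zero_rpow (by linarith : α + 1 ≠ 0)]
      have h3 := h1.tendsto 0
      rw [h2] at h3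
      exact h3.mono_left nhdsWithin_le_nhds
    obtain ⟨c, hcδ, hc0⟩ := ((hlim.eventually (gt_mem_nhds hδ)).and self_mem_nhdsWithin).exists
    have hc0' : c ≠ 0 := (show (0 : ℝ) < c from hc0).ne'
    refine ⟨(c • x, 0), hcδ, ?_⟩
    have : c • x ≠ 0 := smul_ne_zero hc0' hx
    change ‖(0 : H)‖ < coneAperture B m * ‖c • x + 0‖
    rw [norm_zero, add_zero]
    positivity
  · rintro u v h ⟨hE, hcone⟩
    have h0 : u 0 + v 0 ≠ 0 := by
      intro h0
      have h1 : ‖v 0‖ < coneAperture B m * ‖u 0 + v 0‖ := hcone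
      rw [h0, norm_zero, mul_zero] at h1
      exact absurd h1 (not_lt.2 (norm_nonneg _))
    exact h.isSlowFrom_of_cone hm hc hα le_rfl
      (fun t ht => hδf (u t) (v t) ((h.energy_le hs hα ht).trans (le_of_lt hE)))
      (h.vel_ne_zero_or_pos_ne_zero hs hm hc hα (h.exists_pos_ne_zero h0)) (le_of_lt hcone)

end Kirchhoff

theorem theorem5p4 {H : Type*} [NormedAddCommGroup H] [InnerProductSpace ℝ H] [CompleteSpace H]
    [TopologicalSpace.SeparableSpace H] (B : H →L[ℝ] H) (hsymm : B.IsSymmetric)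
    (hcoer : ∃ m : ℝ, 0 < m ∧ ∀ x : H, m * ‖x‖ ^ 2 ≤ ⟪B x, x⟫_ℝ) (α : ℝ) (hα : 0 < α) :
    -- global existence and uniqueness
    (∀ u₀ u₁ : H,
      (∃ u : ℝ → H, Kirchhoff.IsGlobalSolution B α u ∧ Kirchhoff.HasInitialData u u₀ u₁) ∧
      (∀ u w : ℝ → H,
        Kirchhoff.IsGlobalSolution B α u → Kirchhoff.HasInitialData u u₀ u₁ →
        Kirchhoff.IsGlobalSolution B α w → Kirchhoff.HasInitialData w u₀ u₁ →
        ∀ t, 0 ≤ t → u t = w t)) ∧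
    -- classification of decay rates
    (∀ u : ℝ → H, Kirchhoff.IsGlobalSolution B α u → (∃ t, 0 ≤ t ∧ u t ≠ 0) →
      Xor
        (∃ T₀ : ℝ, 0 ≤ T₀ ∧ Kirchhoff.IsSlowFrom α T₀ u)
        (∃ v₀ : H, v₀ ≠ 0 ∧ Kirchhoff.HasFastProfile α v₀ u)) ∧
    -- existence of slow solutions
    (Nontrivial H → ∃ S : Set (H × H), IsOpen S ∧ S.Nonempty ∧
      ∀ u₀ u₁ : H, (u₀, u₁) ∈ S →
        ∀ u : ℝ → H, Kirchhoff.IsGlobalSolution B α u → Kirchhoff.HasInitialData u u₀ u₁ →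
          Kirchhoff.IsSlowFrom α 0 u) ∧
    -- existence of fast solutions
    (∃ ε : ℝ, 0 < ε ∧ ∀ v₀ : H, v₀ ≠ 0 → ‖v₀‖ < ε →
      ∃ u : ℝ → H, Kirchhoff.IsGlobalSolution B α u ∧ Kirchhoff.HasFastProfile α v₀ u) := by
  obtain ⟨m, hm, hc⟩ := hcoer
  refine ⟨fun u₀ u₁ => ⟨?_, ?_⟩, fun u hu hne => ?_, fun _ => ?_, ?_⟩
  · obtain ⟨u, v, h, hu, hv⟩ := Kirchhoff.exists_isPhaseCurve hsymm hm hc hα u₀ u₁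
    exact ⟨u, h.isGlobalSolution hsymm hm hc hα, hu, (h.timeDeriv_eq le_rfl).trans hv⟩
  · intro u w hu hu0 hw hw0 t ht
    exact (hu.isPhaseCurve hsymm hm hc).eq_of_eq_at hsymm hm hc hα
      (hw.isPhaseCurve hsymm hm hc) le_rfl (hu0.1.trans hw0.1.symm) (hu0.2.trans hw0.2.symm) ht
  · rcases (hu.isPhaseCurve hsymm hm hc).slow_or_fast hsymm hm hc hα hne with
      ⟨T₀, hT₀, hslow⟩ | ⟨v₀, hv₀, hfast⟩
    · exact Or.inl ⟨⟨T₀, hT₀, hslow⟩, fun ⟨_, _, hf⟩ =>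
        Kirchhoff.not_isSlowFrom_of_hasFastProfile hα hslow hf⟩
    · exact Or.inr ⟨⟨v₀, hv₀, hfast⟩, fun ⟨_, _, hs⟩ =>
        Kirchhoff.not_isSlowFrom_of_hasFastProfile hα hs hfast⟩
  · obtain ⟨S, hSo, hSn, hS⟩ := Kirchhoff.exists_open_slow hsymm hm hc hα
    refine ⟨S, hSo, hSn, fun u₀ u₁ hmem u hu hu0 => ?_⟩
    refine hS u _ (hu.isPhaseCurve hsymm hm hc) ?_
    rwa [hu0.1, hu0.2]
  · obtain ⟨ε, hε, h⟩ := Kirchhoff.exists_fast_solution hsymm hm hc hα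
    exact ⟨ε, hε, fun v₀ _ hv₀ => h v₀ hv₀⟩
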